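/- Let $d,N\ge 1$, let $A\in\mathbb R^{d\times d}$ be non-singular, let $\Sigma_x,\Sigma_y,\Sigma\in\mathbb R^{d\times d}$ be symmetric positive definite, $\sigma^2\ge 0$ and $\mu_*\in\mathbb R^d$. At each time $t=1,2,\dots$ and for each arm $i\in\{1,\dots,N\}$ let $x_i(t)\sim N(0_d,\Sigma_x)$ be an unobserved context, $y_i(t)=Ax_i(t)+\varepsilon_{y_i}(t)$ with $\varepsilon_{y_i}(t)\sim N(0_d,\Sigma_y)$ the observed output, and $r_i(t)=x_i(t)^\top\mu_*+\varepsilon_{r_i}(t)$ with $\varepsilon_{r_i}(t)\sim N(0,\sigma^2)$ the reward; all contexts and noises are mutually independent, and those of time $t$ are independent of everything that happened before time $t$. Put $\widehat x_i(t)=(A^\top\Sigma_y^{-1}A+\Sigma_x^{-1})^{-1}A^\top\Sigma_y^{-1}y_i(t)$. The Thompson sampling policy does the following at each time $t\ge 1$: with $$B(t)=\Sigma^{-1}+\sum_{\tau=1}^{t-1}\widehat x_{a(\tau)}(\tau)\widehat x_{a(\tau)}(\tau)^\top,\qquad \widehat\mu(t)=B(t)^{-1}\sum_{\tau=1}^{t-1}\widehat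 x_{a(\tau)}(\tau)\,r_{a(\tau)}(\tau),$$ it draws $\widetilde\mu(t)$ from $N(\widehat\mu(t),B(t)^{-1})$ with fresh randomness (that is, this is the conditional law of $\widetilde\mu(t)$ given everything that happened before time $t$ and the contexts and noises at time $t$), selects an arm $a(t)\in\arg\max_{1\le i\le N}\widehat x_i(t)^\top\widetilde\mu(t)$, and observes $r_{a(t)}(t)$. Then $$\lim_{t\to\infty}\widetilde\mu(t)=\mu_*\quad\text{almost surely},$$ and each $\widetilde\mu(t)$, $t\ge 1$, is square-integrable with $\|\mathrm{Cov}(\widetilde\mu(t))\|=O(t^{-1})$ as $t\to\infty$, where $\|\cdot\|$ is the operator norm. -/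

import Mathlib

open MeasureTheory ProbabilityTheory Filter Topology Asymptotics
open scoped NNReal Matrix Matrix.Norms.L2Operator

/-- The parameters of a partially observed contextual bandit with `d`-dimensional contexts and
outputs, together with the prior matrix used by the Thompson sampling policy. -/
structure BanditModel (d : ℕ) where
  /-- sensing matrix, `y = A x + noise` -/
  A : Matrix (Fin d) (Fin d) ℝ
  /-- covariance matrix of the contexts -/
  covX : Matrix (Fin d) (Fin d) ℝ
  /-- covariance matrix of the output noise -/
  covY : Matrix (Fin d) (Fin d) ℝ
  /-- variance of the reward noise -/
  noiseVar : ℝ≥0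
  /-- the true parameter `μ_*` -/
  muStar : EuclideanSpace ℝ (Fin d)
  /-- the matrix `Σ`; the policy starts from `B(1) = Σ⁻¹` -/
  prior : Matrix (Fin d) (Fin d) ℝ
  A_isUnit : IsUnit A
  covX_posDef : covX.PosDef
  covY_posDef : covY.PosDef
  prior_posDef : prior.PosDef

/-- All random quantities of one run with `N` arms: contexts, noises, posterior samples, chosen
arms. Time steps are `t = 1, 2, …`; the values at `t = 0` play no role. -/
structure BanditRun (Ω : Type*) (d N : ℕ) where
  /-- context `x_i(t)` -/
  x : ℕ → Fin N → Ω → EuclideanSpace ℝ (Fin d)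
  /-- output noise of arm `i` at time `t` -/
  epsY : ℕ → Fin N → Ω → EuclideanSpace ℝ (Fin d)
  /-- reward noise of arm `i` at time `t` -/
  epsR : ℕ → Fin N → Ω → ℝ
  /-- the sample `μ̃(t)` -/
  sample : ℕ → Ω → EuclideanSpace ℝ (Fin d)
  /-- the selected arm `a(t)` -/
  arm : ℕ → Ω → Fin N

namespace BanditRun

variable {Ω : Type*} {d N : ℕ}

/-- Output `y_i(t) = A x_i(t) + ε_{y_i}(t)`. -/
noncomputable def output (R : BanditRun Ω d N) (M : BanditModel d) (t : ℕ) (i : Fin N) (ω : Ω) :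
    EuclideanSpace ℝ (Fin d) :=
  WithLp.toLp 2 (M.A *ᵥ (R.x t i ω).ofLp) + R.epsY t i ω

/-- Reward `r_i(t) = x_i(t)ᵀ μ_* + ε_{r_i}(t)`. -/
noncomputable def reward (R : BanditRun Ω d N) (M : BanditModel d) (t : ℕ) (i : Fin N) (ω : Ω) :
    ℝ :=
  inner ℝ (R.x t i ω) M.muStar + R.epsR t i ω

/-- Context estimate `x̂_i(t) = (Aᵀ Σ_y⁻¹ A + Σ_x⁻¹)⁻¹ Aᵀ Σ_y⁻¹ y_i(t)`. -/
noncomputable def xhat (R : BanditRun Ω d N) (M : BanditModel d) (t : ℕ) (i : Fin N) (ω : Ω) :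
    EuclideanSpace ℝ (Fin d) :=
  WithLp.toLp 2
    (((M.Aᵀ * M.covY⁻¹ * M.A + M.covX⁻¹)⁻¹ * M.Aᵀ * M.covY⁻¹) *ᵥ (R.output M t i ω).ofLp)

/-- Estimate `x̂_{a(t)}(t)` of the context of the selected arm. -/
noncomputable def chosenXhat (R : BanditRun Ω d N) (M : BanditModel d) (t : ℕ) (ω : Ω) :
    EuclideanSpace ℝ (Fin d) :=
  R.xhat M t (R.arm t ω) ω

/-- Observed reward `r_{a(t)}(t)`. -/
noncomputable def chosenReward (R : BanditRun Ω d N) (M : BanditModel d) (t : ℕ) (ω : Ω) : ℝ :=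
  R.reward M t (R.arm t ω) ω

/-- `B(t) = Σ⁻¹ + ∑_{1 ≤ τ < t} x̂_{a(τ)}(τ) x̂_{a(τ)}(τ)ᵀ`. -/
noncomputable def B (R : BanditRun Ω d N) (M : BanditModel d) (t : ℕ) (ω : Ω) :
    Matrix (Fin d) (Fin d) ℝ :=
  M.prior⁻¹ + ∑ τ ∈ Finset.Ico 1 t,
    Matrix.vecMulVec (R.chosenXhat M τ ω).ofLp (R.chosenXhat M τ ω).ofLp

/-- `μ̂(t) = B(t)⁻¹ ∑_{1 ≤ τ < t} r_{a(τ)}(τ) x̂_{a(τ)}(τ)`. -/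
noncomputable def muHat (R : BanditRun Ω d N) (M : BanditModel d) (t : ℕ) (ω : Ω) :
    EuclideanSpace ℝ (Fin d) :=
  WithLp.toLp 2 ((R.B M t ω)⁻¹ *ᵥ
    (∑ τ ∈ Finset.Ico 1 t, R.chosenReward M τ ω • R.chosenXhat M τ ω).ofLp)

/-- The triples (context, output noise, reward noise) of all arms at time `t`. -/
def env (R : BanditRun Ω d N) (t : ℕ) (ω : Ω) :
    Fin N → EuclideanSpace ℝ (Fin d) × EuclideanSpace ℝ (Fin d) × ℝ :=
  fun i => (R.x t i ω, R.epsY t i ω, R.epsR t i ω)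

/-- The σ-algebra generated by everything that happened at times `1, …, t - 1`. -/
@[reducible] def history (R : BanditRun Ω d N) (t : ℕ) : MeasurableSpace Ω :=
  ⨆ τ ∈ Finset.Ico 1 t,
    (MeasurableSpace.comap (R.env τ) inferInstance ⊔
      MeasurableSpace.comap (R.sample τ) inferInstance ⊔
      MeasurableSpace.comap (R.arm τ) inferInstance)

/-- `R` is a run of the Thompson sampling policy in the bandit `M` with `N` arms. -/
structure IsThompsonSampling [MeasurableSpace Ω] (R : BanditRun Ω d N) (M : BanditModel d)
    (P : Measure Ω) : Prop where
  measurable_env : ∀ t, 1 ≤ t → Measurable (R.env t)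
  measurable_sample : ∀ t, 1 ≤ t → Measurable (R.sample t)
  measurable_arm : ∀ t, 1 ≤ t → Measurable (R.arm t)
  /-- At each time, contexts and noises of all arms are mutually independent, with laws
  `N(0, Σ_x)`, `N(0, Σ_y)` and `N(0, σ²)`. -/
  env_law : ∀ t, 1 ≤ t → P.map (R.env t) = Measure.pi fun _ : Fin N =>
    (multivariateGaussian 0 M.covX).prod
      ((multivariateGaussian 0 M.covY).prod (gaussianReal 0 M.noiseVar))
  /-- Contexts and noises at time `t` are independent of the past. -/
  env_indep : ∀ t, 1 ≤ t →
    Indep (R.history t) (MeasurableSpace.comap (R.env t) inferInstance) P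
  /-- `μ̃(t)` is drawn from `N(μ̂(t), B(t)⁻¹)` with fresh randomness: this is its conditional law
  given the past and the current contexts and noises. -/
  sample_law : ∀ t, 1 ≤ t → ∀ s : Set (EuclideanSpace ℝ (Fin d)), MeasurableSet s →
    P⟦R.sample t ⁻¹' s | R.history t ⊔ MeasurableSpace.comap (R.env t) inferInstance⟧
      =ᵐ[P] fun ω => (multivariateGaussian (R.muHat M t ω) (R.B M t ω)⁻¹).real s
  /-- The selected arm maximizes `x̂_i(t)ᵀ μ̃(t)`. -/
  arm_max : ∀ t, 1 ≤ t → ∀ ω i,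
    inner ℝ (R.xhat M t i ω) (R.sample t ω) ≤ inner ℝ (R.chosenXhat M t ω) (R.sample t ω)

end BanditRun

/-- Covariance matrix of a random vector. -/
noncomputable def randomVectorCov {Ω : Type*} [MeasurableSpace Ω] {d : ℕ}
    (X : Ω → EuclideanSpace ℝ (Fin d)) (P : Measure Ω) : Matrix (Fin d) (Fin d) ℝ :=
  Matrix.of fun i j => cov[fun ω => X ω i, fun ω => X ω j; P]

/-! The context estimate is the linear regression of the context on the output. The reward is
therefore `x̂ᵀμ_*` plus a centred residual that is uncorrelated with the estimate, hence, by joint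
Gaussianity, independent of it (`indepFun_estimate_residual`). So `μ̂(t)` is a ridge regression
estimator with error `B(t)⁻¹ (∑ score - Σ⁻¹ μ_*)`, where a score is the residual times the estimate
of the chosen arm (`muHat_sub_muStar`). Two facts control this error.

Scores at different times are orthogonal in `L²` (`integral_inner_score`): ties have probability
zero, so the arm chosen at time `t` is almost surely a function of the sample and the estimates at
time `t`, and these, jointly with the past, are independent of each residual at time `t`. Hence the
sum of scores has second moment `O(t)`, and it is `o(t)` almost surely by a strong law for
orthogonal vectors.

The matrix `B(t)` grows linearly whatever arms are chosen (`exists_norm_B_inv_le`). In every unit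
direction, with probability at least `3/4`, the estimates of all arms at once have a component of
size at least `η`; compactness of the sphere leaves finitely many such events to watch, and an
exponential Markov bound shows that each occurs in a positive fraction of the steps. Thus `‖B(t)⁻¹‖
= O(1/t)` outside an event whose probability decays faster than any power of `t`, and on that event
the prior still bounds `‖B(t)⁻¹‖`.

Together these give `μ̂(t) → μ_*` almost surely and in mean square at rate `1/t`. Given the past,
the sample is Gaussian around `μ̂(t)` with covariance `B(t)⁻¹`, so its deviation has moment of order
`2q` bounded by a multiple of `t^(-q)`: `q = 2` is summable and gives almost sure convergence, `q =
1` gives the covariance bound. -/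

/-! ### Almost sure convergence from moment bounds; a strong law for orthogonal vectors -/

/-- The moments are summable, so the series of `p`-th powers has finite integral and converges
almost everywhere; its terms then tend to zero. -/
theorem ae_tendsto_zero_of_lintegral_enorm_pow_le {Ω F : Type*} [MeasurableSpace Ω]
    {P : Measure Ω} [NormedAddCommGroup F] {f : ℕ → Ω → F} (hf : ∀ n, AEStronglyMeasurable (f n) P)
    {p : ℕ} (hp : p ≠ 0) (C : ℝ)
    (h : ∀ n, ∫⁻ ω, ‖f n ω‖ₑ ^ p ∂P ≤ ENNReal.ofReal (C * (((n : ℝ) + 1) ^ 2)⁻¹)) :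
    ∀ᵐ ω ∂P, Tendsto (fun n => f n ω) atTop (𝓝 0) := by
  have hm : ∀ n, AEMeasurable (fun ω => ‖f n ω‖ₑ ^ p) P := fun n => (hf n).enorm.pow_const p
  have hs : Summable fun n : ℕ => C * (((n : ℝ) + 1) ^ 2)⁻¹ := by
    have := (summable_nat_add_iff 1).2 (Real.summable_nat_pow_inv.2 (one_lt_two))
    simpa using this.mul_left C
  have hfin : ∫⁻ ω, ∑' n, ‖f n ω‖ₑ ^ p ∂P ≠ ⊤ := by
    rw [lintegral_tsum hm]
    exact ne_top_of_le_ne_top hs.tsum_ofReal_ne_top (ENNReal.tsum_le_tsum h)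
  filter_upwards [ae_lt_top' (AEMeasurable.tsum hm) hfin] with ω hω
  have h0 := ENNReal.tendsto_atTop_zero_of_tsum_ne_top hω.ne
  rw [tendsto_zero_iff_norm_tendsto_zero]
  have h1 : Tendsto (fun n => (‖f n ω‖ₑ ^ p) ^ ((p : ℝ)⁻¹)) atTop (𝓝 0) := by
    have := h0.ennrpow_const ((p : ℝ)⁻¹)
    rwa [ENNReal.zero_rpow_of_pos (by positivity)] at this
  have h2 : Tendsto (fun n => ‖f n ω‖ₑ) atTop (𝓝 0) := by
    refine h1.congr fun n => ?_
    rw [← ENNReal.rpow_natCast, ← ENNReal.rpow_mul, mul_inv_cancel₀ (by positivity),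
      ENNReal.rpow_one]
  simpa [Function.comp_def] using (ENNReal.tendsto_toReal ENNReal.zero_ne_top).comp h2

section Orthogonal

variable {Ω E : Type*} [MeasurableSpace Ω] {P : Measure Ω} [NormedAddCommGroup E]
  [InnerProductSpace ℝ E]

theorem MemLp.integrable_inner_two {f g : Ω → E} (hf : MemLp f 2 P) (hg : MemLp g 2 P) :
    Integrable (fun ω => inner ℝ (f ω) (g ω)) P := by
  refine (hf.norm.integrable_mul hg.norm).mono' (hf.1.inner hg.1) (ae_of_all _ fun ω => ?_)
  exact norm_inner_le_norm _ _

theorem integral_norm_sq_sum_le_of_orthogonal {X : ℕ → Ω → E} (hX : ∀ n, MemLp (X n) 2 P) {C : ℝ}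
    (hC : ∀ n, ∫ ω, ‖X n ω‖ ^ 2 ∂P ≤ C)
    (horth : ∀ m n, m < n → ∫ ω, inner ℝ (X m ω) (X n ω) ∂P = 0) (n : ℕ) :
    ∫ ω, ‖∑ i ∈ Finset.range n, X i ω‖ ^ 2 ∂P ≤ C * n := by
  induction n with
  | zero => simp
  | succ n ih =>
    have hS : MemLp (fun ω => ∑ i ∈ Finset.range n, X i ω) 2 P :=
      memLp_finsetSum _ fun i _ => hX i
    have hcross : ∫ ω, inner ℝ (∑ i ∈ Finset.range n, X i ω) (X n ω) ∂P = 0 := by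
      simp_rw [sum_inner]
      rw [integral_finsetSum _ fun i _ => MemLp.integrable_inner_two (hX i) (hX n)]
      exact Finset.sum_eq_zero fun i hi => horth i n (Finset.mem_range.1 hi)
    simp_rw [Finset.sum_range_succ, norm_add_sq_real]
    rw [integral_add, integral_add, integral_const_mul, hcross]
    · push_cast
      linarith [hC n]
    · exact hS.integrable_norm_pow (by norm_num)
    · exact (MemLp.integrable_inner_two hS (hX n)).const_mul 2
    · exact (hS.integrable_norm_pow (by norm_num)).add
        ((MemLp.integrable_inner_two hS (hX n)).const_mul 2)
    · exact (hX n).integrable_norm_pow (by norm_num)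

/-- Subsequence argument: `S m` is the norm of the partial sum up to `m²`, and `T m` bounds the
change until the next square. Their second moments are `O(m²)`, which is summable after division by
`m⁴`, so no maximal inequality is needed. -/
theorem ae_tendsto_inv_smul_sum_of_orthogonal {X : ℕ → Ω → E} (hX : ∀ n, MemLp (X n) 2 P) {C : ℝ}
    (hC : ∀ n, ∫ ω, ‖X n ω‖ ^ 2 ∂P ≤ C)
    (horth : ∀ m n, m < n → ∫ ω, inner ℝ (X m ω) (X n ω) ∂P = 0) :
    ∀ᵐ ω ∂P, Tendsto (fun n : ℕ => (n : ℝ)⁻¹ * ‖∑ i ∈ Finset.range n, X i ω‖) atTop (𝓝 0) := by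
  set S : ℕ → Ω → ℝ := fun m ω => ‖∑ i ∈ Finset.range (m ^ 2), X i ω‖ with hSdef
  set T : ℕ → Ω → ℝ := fun m ω => ∑ i ∈ Finset.Ico (m ^ 2) ((m + 1) ^ 2), ‖X i ω‖ with hTdef
  have hC0 : 0 ≤ C := (integral_nonneg fun ω => by positivity).trans (hC 0)
  have hSm : ∀ m, MemLp (S m) 2 P := fun m => (memLp_finsetSum _ fun i _ => hX i).norm
  have hTm : ∀ m, MemLp (T m) 2 P := fun m => memLp_finsetSum _ fun i _ => (hX i).norm
  have hSi : ∀ m, ∫ ω, S m ω ^ 2 ∂P ≤ C * (m : ℝ) ^ 2 := fun m => by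
    have h := integral_norm_sq_sum_le_of_orthogonal hX hC horth (m ^ 2)
    rwa [Nat.cast_pow] at h
  have hTi : ∀ m, ∫ ω, T m ω ^ 2 ∂P ≤ C * (2 * (m : ℝ) + 1) ^ 2 := fun m => by
    have hcard : (Finset.Ico (m ^ 2) ((m + 1) ^ 2)).card = 2 * m + 1 := by
      rw [Nat.card_Ico, add_sq]; omega
    calc ∫ ω, T m ω ^ 2 ∂P
        ≤ ∫ ω, (2 * (m : ℝ) + 1) * ∑ i ∈ Finset.Ico (m ^ 2) ((m + 1) ^ 2), ‖X i ω‖ ^ 2 ∂P := by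
          refine integral_mono (hTm m).integrable_sq ?_ fun ω => ?_
          · exact (integrable_finsetSum _ fun i _ =>
              (hX i).integrable_norm_pow (by norm_num)).const_mul _
          · have := sq_sum_le_card_mul_sum_sq (s := Finset.Ico (m ^ 2) ((m + 1) ^ 2))
              (f := fun i => ‖X i ω‖)
            rw [hcard] at this
            exact_mod_cast this
      _ ≤ (2 * (m : ℝ) + 1) * ((2 * (m : ℝ) + 1) * C) := by
          rw [integral_const_mul, integral_finsetSum _ fun i _ =>
              (hX i).integrable_norm_pow (by norm_num)]
          gcongr
          calc _ ≤ ∑ i ∈ Finset.Ico (m ^ 2) ((m + 1) ^ 2), C := Finset.sum_le_sum fun i _ => hC i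
            _ = _ := by rw [Finset.sum_const, hcard]; simp
      _ = _ := by ring
  have hR : ∀ᵐ ω ∂P, Tendsto (fun m : ℕ => (((m : ℝ) + 1) ^ 2)⁻¹ * (S (m + 1) ω + T (m + 1) ω)) atTop
      (𝓝 0) := by
    -- With `x = m + 1`, the constant is `2 (1 + 9)`: the bounds are `C x²` for `S` and `C (2x + 1)²
    -- ≤ 9 C x²` for `T`.
    refine ae_tendsto_zero_of_lintegral_enorm_pow_le (p := 2)
      (f := fun m ω => (((m : ℝ) + 1) ^ 2)⁻¹ * (S (m + 1) ω + T (m + 1) ω))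
      (fun m => (((hSm _).add (hTm _)).const_mul _).1) two_ne_zero (20 * C) fun m => ?_
    have hint : Integrable (fun ω => ((((m : ℝ) + 1) ^ 2)⁻¹ * (S (m + 1) ω + T (m + 1) ω)) ^ 2) P :=
      (((hSm _).add (hTm _)).const_mul _).integrable_sq
    have : ∫⁻ ω, ‖(((m : ℝ) + 1) ^ 2)⁻¹ * (S (m + 1) ω + T (m + 1) ω)‖ₑ ^ 2 ∂P
        = ENNReal.ofReal (∫ ω, ((((m : ℝ) + 1) ^ 2)⁻¹ * (S (m + 1) ω + T (m + 1) ω)) ^ 2 ∂P) := by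
      rw [ofReal_integral_eq_lintegral_ofReal hint (ae_of_all _ fun ω => sq_nonneg _)]
      refine lintegral_congr fun ω => ?_
      rw [← enorm_pow, Real.enorm_eq_ofReal (sq_nonneg _)]
    rw [this]
    refine ENNReal.ofReal_le_ofReal ?_
    calc _ ≤ ∫ ω, ((((m : ℝ) + 1) ^ 2)⁻¹) ^ 2 * (2 * (S (m + 1) ω ^ 2 + T (m + 1) ω ^ 2)) ∂P := by
          refine integral_mono hint
            ((((hSm _).integrable_sq.add (hTm _).integrable_sq).const_mul _).const_mul _) fun ω => ?_
          simp only [mul_pow]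
          gcongr
          linarith [two_mul_le_add_sq (S (m + 1) ω) (T (m + 1) ω),
            add_sq (S (m + 1) ω) (T (m + 1) ω)]
      _ ≤ ((((m : ℝ) + 1) ^ 2)⁻¹) ^ 2 * (2 * (C * ((m : ℝ) + 1) ^ 2 + C * (3 * ((m : ℝ) + 1)) ^ 2)) := by
          rw [integral_const_mul, integral_const_mul,
            integral_add (hSm _).integrable_sq (hTm _).integrable_sq]
          have h1 := hSi (m + 1)
          have h2 := hTi (m + 1)
          push_cast at h1 h2
          have h3 : C * (2 * ((m : ℝ) + 1) + 1) ^ 2 ≤ C * (3 * ((m : ℝ) + 1)) ^ 2 := by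
            gcongr
            have : (0 : ℝ) ≤ m := Nat.cast_nonneg m
            linarith
          gcongr
          exact h2.trans h3
      _ = _ := by field_simp; ring
  filter_upwards [hR] with ω hω
  -- The shift by one matches `hR`, whose `m`-th term concerns the square `(m + 1)²`.
  have hsq : Tendsto (fun n : ℕ => Nat.sqrt n - 1) atTop atTop :=
    (tendsto_sub_atTop_nat 1).comp
      (tendsto_atTop.2 fun b => (eventually_ge_atTop (b ^ 2)).mono fun n hn => by
        rw [Nat.le_sqrt']; exact hn)
  refine squeeze_zero' (Eventually.of_forall fun n => by positivity) ?_ (hω.comp hsq)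
  filter_upwards [eventually_ge_atTop 1] with n hn
  obtain ⟨m, hm⟩ : ∃ m, Nat.sqrt n = m + 1 :=
    Nat.exists_eq_succ_of_ne_zero (Nat.sqrt_pos.2 hn).ne'
  have hle : (m + 1) ^ 2 ≤ n := by rw [← hm]; exact Nat.sqrt_le' n
  have hlt : n < (m + 1 + 1) ^ 2 := by rw [← hm]; exact Nat.lt_succ_sqrt' n
  simp only [Function.comp, hm, Nat.add_sub_cancel]
  have hb : ‖∑ i ∈ Finset.range n, X i ω‖ ≤ S (m + 1) ω + T (m + 1) ω := by
    rw [← Finset.sum_range_add_sum_Ico _ hle]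
    refine (norm_add_le _ _).trans (add_le_add le_rfl ((norm_sum_le _ _).trans ?_))
    exact Finset.sum_le_sum_of_subset_of_nonneg
      (Finset.Ico_subset_Ico le_rfl hlt.le) fun _ _ _ => norm_nonneg _
  have hn' : (((m : ℝ) + 1) ^ 2) ≤ n := by exact_mod_cast hle
  gcongr

end Orthogonal

/-! ### Operator norm bounds -/

section Matrices

variable {d : ℕ}

theorem dotProduct_ofLp_eq_inner (u v : EuclideanSpace ℝ (Fin d)) :
    u.ofLp ⬝ᵥ v.ofLp = inner ℝ u v := by
  simp [PiLp.inner_apply, dotProduct, mul_comm]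

/-- For `u = B⁻¹ w`, coercivity and Cauchy–Schwarz give `b ‖u‖² ≤ ⟨u, w⟩ ≤ ‖u‖ ‖w‖`. -/
theorem norm_inv_le_of_coercive {B : Matrix (Fin d) (Fin d) ℝ} (hB : B.PosDef) {b : ℝ} (hb : 0 < b)
    (h : ∀ u : EuclideanSpace ℝ (Fin d), b * ‖u‖ ^ 2 ≤ u.ofLp ⬝ᵥ (B *ᵥ u.ofLp)) :
    ‖B⁻¹‖ ≤ b⁻¹ := by
  rw [Matrix.l2_opNorm_def]
  refine ContinuousLinearMap.opNorm_le_bound _ (by positivity) fun w => ?_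
  set u : EuclideanSpace ℝ (Fin d) := WithLp.toLp 2 (B⁻¹ *ᵥ w.ofLp) with hu
  change ‖u‖ ≤ _
  have hBu : B *ᵥ u.ofLp = w.ofLp := by
    rw [hu]
    simp [Matrix.mulVec_mulVec, Matrix.mul_nonsing_inv _ ((Matrix.isUnit_iff_isUnit_det _).1 hB.isUnit)]
  have h1 := h u
  rw [hBu, dotProduct_ofLp_eq_inner] at h1
  have h2 := h1.trans (real_inner_le_norm u w)
  rw [inv_mul_eq_div, le_div_iff₀ hb]
  rcases (norm_nonneg u).eq_or_lt with h0 | h0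
  · rw [← h0]; simp
  · nlinarith

theorem l2_opNorm_le_of_abs_entry_le {C : Matrix (Fin d) (Fin d) ℝ} {K : ℝ}
    (h : ∀ i j, |C i j| ≤ K) : ‖C‖ ≤ (∑ i, ∑ j, ‖Matrix.single (i : Fin d) (j : Fin d) (1 : ℝ)‖) * K := by
  conv_lhs => rw [Matrix.matrix_eq_sum_single C]
  refine (norm_sum_le _ _).trans ?_
  rw [Finset.sum_mul]
  refine Finset.sum_le_sum fun i _ => (norm_sum_le _ _).trans ?_
  rw [Finset.sum_mul]
  refine Finset.sum_le_sum fun j _ => ?_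
  have : Matrix.single i j (C i j) = C i j • Matrix.single i j (1 : ℝ) := by simp
  rw [this, norm_smul, mul_comm, Real.norm_eq_abs]
  exact mul_le_mul_of_nonneg_left (h i j) (norm_nonneg _)

end Matrices

/-! ### Gaussian laws as a measurable function of mean and covariance -/

section GaussianKernel

open scoped MatrixOrder

variable {d : ℕ}

theorem isClosed_setOf_posSemidef : IsClosed {S : Matrix (Fin d) (Fin d) ℝ | S.PosSemidef} := by
  have : {S : Matrix (Fin d) (Fin d) ℝ | S.PosSemidef}
      = {S | Sᴴ = S} ∩ ⋂ x : Fin d → ℝ, {S | 0 ≤ star x ⬝ᵥ (S *ᵥ x)} := by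
    ext S
    simp [Matrix.posSemidef_iff_dotProduct_mulVec, Matrix.IsHermitian]
  rw [this]
  refine (isClosed_eq (by fun_prop) (by fun_prop)).inter (isClosed_iInter fun x => ?_)
  exact isClosed_le (by fun_prop) (by fun_prop)

/-- The square root is continuous on the closed cone of positive semidefinite matrices, and it takes
the default value `0` elsewhere. -/
theorem measurable_sqrt_of_apply (i j : Fin d) :
    Measurable fun p : Fin d → Fin d → ℝ => CFC.sqrt (Matrix.of p) i j := by
  classical
  have hof : Continuous fun p : Fin d → Fin d → ℝ => Matrix.of p := continuous_id
  set s : Set (Fin d → Fin d → ℝ) := {p | (Matrix.of p).PosSemidef} with hs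
  have hsm : MeasurableSet s := (isClosed_setOf_posSemidef.preimage hof).measurableSet
  have heq : (fun p : Fin d → Fin d → ℝ => CFC.sqrt (Matrix.of p) i j)
      = s.piecewise (fun p => CFC.sqrt (Matrix.of p) i j) (fun _ => 0) := by
    funext p
    by_cases hp : p ∈ s
    · simp [hp]
    · rw [Set.piecewise_eq_of_notMem _ _ _ hp, CFC.sqrt, cfcₙ_apply_of_not_predicate]
      · rfl
      · rwa [Matrix.nonneg_iff_posSemidef]
  rw [heq]
  refine ContinuousOn.measurable_piecewise ?_ continuousOn_const hsm
  have h1 : ContinuousOn (fun p : Fin d → Fin d → ℝ => CFC.sqrt (Matrix.of p)) s :=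
    CFC.continuousOn_sqrt.comp hof.continuousOn fun p hp => Matrix.PosSemidef.nonneg hp
  have h2 : Continuous fun M : Matrix (Fin d) (Fin d) ℝ => M i j := by fun_prop
  exact h2.comp_continuousOn h1

/-- All these laws are images of one standard Gaussian under `z ↦ μ + √S z`, which is measurable
jointly in the parameters and `z`. -/
theorem measurable_multivariateGaussian :
    Measurable fun p : EuclideanSpace ℝ (Fin d) × (Fin d → Fin d → ℝ) =>
      multivariateGaussian p.1 (Matrix.of p.2) := by
  set f : (EuclideanSpace ℝ (Fin d) × (Fin d → Fin d → ℝ)) × EuclideanSpace ℝ (Fin d) →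
      EuclideanSpace ℝ (Fin d) := fun q =>
    q.1.1 + Matrix.toEuclideanCLM (𝕜 := ℝ) (CFC.sqrt (Matrix.of q.1.2)) q.2 with hfdef
  have hf : Measurable f := by
    have h0 : Measurable fun q : (EuclideanSpace ℝ (Fin d) × (Fin d → Fin d → ℝ)) ×
        EuclideanSpace ℝ (Fin d) => q.1.1 := by fun_prop
    have h1 : Measurable fun q : (EuclideanSpace ℝ (Fin d) × (Fin d → Fin d → ℝ)) ×
        EuclideanSpace ℝ (Fin d) =>
          Matrix.toEuclideanCLM (𝕜 := ℝ) (CFC.sqrt (Matrix.of q.1.2)) q.2 := by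
      refine (WithLp.measurable_toLp 2 (Fin d → ℝ)).comp (measurable_pi_lambda _ fun i => ?_)
      change Measurable fun q : (EuclideanSpace ℝ (Fin d) × (Fin d → Fin d → ℝ)) ×
        EuclideanSpace ℝ (Fin d) => ∑ j, CFC.sqrt (Matrix.of q.1.2) i j * q.2 j
      refine Finset.measurable_sum _ fun j _ => ?_
      have h2 : Measurable fun q : (EuclideanSpace ℝ (Fin d) × (Fin d → Fin d → ℝ)) ×
        EuclideanSpace ℝ (Fin d) => q.2 j := by fun_prop
      exact ((measurable_sqrt_of_apply i j).comp (measurable_snd.comp measurable_fst)).mul h2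
    exact h0.add h1
  refine Measure.measurable_of_measurable_coe _ fun s hs => ?_
  have : (fun p : EuclideanSpace ℝ (Fin d) × (Fin d → Fin d → ℝ) =>
      multivariateGaussian p.1 (Matrix.of p.2) s)
      = fun p => stdGaussian (EuclideanSpace ℝ (Fin d)) (Prod.mk p ⁻¹' (f ⁻¹' s)) := by
    funext p
    rw [multivariateGaussian, Measure.map_apply (by fun_prop) hs]
    rfl
  rw [this]
  exact measurable_measure_prodMk_left (hf hs)

/-- The Markov kernel `(μ, S) ↦ N(μ, S)`. -/
noncomputable def gaussianKernel (d : ℕ) :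
    Kernel (EuclideanSpace ℝ (Fin d) × (Fin d → Fin d → ℝ)) (EuclideanSpace ℝ (Fin d)) where
  toFun p := multivariateGaussian p.1 (Matrix.of p.2)
  measurable' := measurable_multivariateGaussian

theorem gaussianKernel_apply (p : EuclideanSpace ℝ (Fin d) × (Fin d → Fin d → ℝ)) :
    gaussianKernel d p = multivariateGaussian p.1 (Matrix.of p.2) := rfl

instance : IsMarkovKernel (gaussianKernel d) :=
  ⟨fun p => by rw [gaussianKernel_apply]; infer_instance⟩

/-- The moment of order `2 q` of the norm of a standard Gaussian vector. -/
noncomputable def stdGaussianMoment (d q : ℕ) : ENNReal :=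
  ∫⁻ z, ‖z‖ₑ ^ (2 * q) ∂(stdGaussian (EuclideanSpace ℝ (Fin d)))

theorem IsGaussian.lintegral_enorm_pow_ne_top {E : Type*} [NormedAddCommGroup E] [NormedSpace ℝ E]
    [MeasurableSpace E] [BorelSpace E] [SecondCountableTopology E] [CompleteSpace E]
    (μ : Measure E) [IsGaussian μ] (p : ℕ) : ∫⁻ z, ‖z‖ₑ ^ p ∂μ ≠ ⊤ := by
  rcases eq_or_ne p 0 with rfl | hp
  · simp
  have h := (IsGaussian.memLp_id μ p (by simp)).eLpNorm_lt_top
  rw [eLpNorm_lt_top_iff_lintegral_rpow_enorm_lt_top (by exact_mod_cast hp) (by simp)] at h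
  simpa using h.ne

theorem stdGaussianMoment_ne_top (d q : ℕ) : stdGaussianMoment d q ≠ ⊤ :=
  IsGaussian.lintegral_enorm_pow_ne_top _ _

/-- The deviation from the mean is `√S z` with `z` standard Gaussian, and `‖√S‖² = ‖S‖`. -/
theorem lintegral_enorm_sub_pow_multivariateGaussian_le (μ : EuclideanSpace ℝ (Fin d))
    {S : Matrix (Fin d) (Fin d) ℝ} (hS : S.PosSemidef) (q : ℕ) :
    ∫⁻ y, ‖y - μ‖ₑ ^ (2 * q) ∂(multivariateGaussian μ S) ≤ ‖S‖ₑ ^ q * stdGaussianMoment d q := by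
  rw [multivariateGaussian, lintegral_map (by fun_prop) (by fun_prop), stdGaussianMoment,
    ← lintegral_const_mul _ (by fun_prop)]
  refine lintegral_mono fun z => ?_
  have hn : ‖CFC.sqrt S‖ₑ ^ 2 = ‖S‖ₑ := by
    have h := CFC.nnnorm_sqrt S hS.nonneg
    rw [enorm_eq_nnnorm, enorm_eq_nnnorm, h, ← ENNReal.coe_pow, NNReal.sq_sqrt]
  rw [add_sub_cancel_left, pow_mul, pow_mul, ← mul_pow, ← hn, ← mul_pow]
  gcongr
  exact ContinuousLinearMap.le_opENorm (Matrix.toEuclideanCLM (𝕜 := ℝ) (CFC.sqrt S)) z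

end GaussianKernel

/-! ### Conditional laws, independence and covariance -/

section ConditionalLaw

variable {Ω Θ F : Type*} {m m0 : MeasurableSpace Ω} {P : @Measure Ω m0} [IsProbabilityMeasure P]
  [MeasurableSpace Θ] [MeasurableSpace F] {κ : Kernel Θ F} [IsMarkovKernel κ] {θ : Ω → Θ} {Y : Ω → F}

theorem measure_inter_preimage_of_condLaw (hm : m ≤ m0) (hY : Measurable[m0] Y)
    (hlaw : ∀ s, MeasurableSet s → P⟦Y ⁻¹' s | m⟧ =ᵐ[P] fun ω => (κ (θ ω)).real s)
    {A : Set Ω} (hA : MeasurableSet[m] A) {s : Set F} (hs : MeasurableSet s) :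
    P (A ∩ Y ⁻¹' s) = ∫⁻ ω in A, κ (θ ω) s ∂P := by
  have h1 : ∫ ω in A, (P⟦Y ⁻¹' s | m⟧) ω ∂P = P.real (A ∩ Y ⁻¹' s) := by
    rw [setIntegral_condExp hm ((integrable_const _).indicator (hY hs)) hA,
      integral_indicator_const _ (hY hs), measureReal_restrict_apply (hY hs), Set.inter_comm]
    simp
  have h2 : P.real (A ∩ Y ⁻¹' s) = ∫ ω in A, (κ (θ ω)).real s ∂P := by
    rw [← h1]
    exact integral_congr_ae (ae_restrict_of_ae (hlaw s hs))
  have hint : Integrable (fun ω => (κ (θ ω)).real s) (P.restrict A) :=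
    (integrable_condExp.congr (hlaw s hs)).restrict
  rw [← ofReal_measureReal, h2, ofReal_integral_eq_lintegral_ofReal hint
    (ae_of_all _ fun _ => measureReal_nonneg)]
  exact lintegral_congr fun ω => ofReal_measureReal

theorem map_prodMk_eq_compProd_of_condLaw (hm : m ≤ m0) (hY : Measurable[m0] Y)
    (hlaw : ∀ s, MeasurableSet s → P⟦Y ⁻¹' s | m⟧ =ᵐ[P] fun ω => (κ (θ ω)).real s)
    (hθ : Measurable[m] θ) :
    P.map (fun ω => (θ ω, Y ω)) = (P.map θ) ⊗ₘ κ := by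
  have hθ0 : Measurable[m0] θ := hθ.mono hm le_rfl
  refine Measure.ext_prod fun {s t} hs ht => ?_
  rw [Measure.map_apply (hθ0.prodMk hY) (hs.prod ht), Measure.compProd_apply_prod hs ht,
    setLIntegral_map hs (κ.measurable_coe ht) hθ0,
    ← measure_inter_preimage_of_condLaw hm hY hlaw (hθ hs) ht]
  rfl

/-- Fresh randomness: the parameter `θ` of the conditional law of `Y` is known from `h` alone, so
conditioning also on `v` adds nothing. On a rectangle the probability becomes the integral of an
`h`-measurable function times an indicator of `v`, and it factors. -/
theorem indepFun_prodMk_of_condLaw {U V : Type*} [MeasurableSpace U] [MeasurableSpace V]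
    {h : MeasurableSpace Ω} {u : Ω → U} {v : Ω → V}
    (hh : h ≤ m0) (hv : Measurable[m0] v) (hY : Measurable[m0] Y)
    (hind : Indep h (MeasurableSpace.comap v inferInstance) P)
    (hlaw : ∀ s, MeasurableSet s →
      P⟦Y ⁻¹' s | h ⊔ MeasurableSpace.comap v inferInstance⟧ =ᵐ[P] fun ω => (κ (θ ω)).real s)
    (hθ : Measurable[h] θ) (hu : Measurable[h] u) :
    IndepFun (fun ω => (u ω, Y ω)) v P := by
  have hu0 : Measurable[m0] u := hu.mono hh le_rfl
  have hle : h ⊔ MeasurableSpace.comap v inferInstance ≤ m0 := sup_le hh hv.comap_le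
  rw [indepFun_iff_map_prod_eq_prod_map_map (hu0.prodMk hY).aemeasurable hv.aemeasurable]
  refine Measure.ext_prod₃_iff'.2 fun {s t w} hs ht hw => ?_
  have hpart : ∀ w : Set V, MeasurableSet w → P ((u ⁻¹' s ∩ Y ⁻¹' t) ∩ v ⁻¹' w)
      = (∫⁻ ω, (u ⁻¹' s).indicator (fun ω => κ (θ ω) t) ω ∂P) * P (v ⁻¹' w) := fun w hw => by
    have hus : MeasurableSet[h] (u ⁻¹' s) := hu hs
    have hvw : MeasurableSet[MeasurableSpace.comap v inferInstance] (v ⁻¹' w) := ⟨w, hw, rfl⟩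
    have hA : MeasurableSet[h ⊔ MeasurableSpace.comap v inferInstance] (u ⁻¹' s ∩ v ⁻¹' w) :=
      MeasurableSet.inter (le_sup_left (b := MeasurableSpace.comap v inferInstance) _ hus)
        (le_sup_right (a := h) _ hvw)
    rw [Set.inter_right_comm, measure_inter_preimage_of_condLaw hle hY hlaw hA ht,
      ← lintegral_indicator (hle _ hA)]
    have hf : Measurable[h] ((u ⁻¹' s).indicator (fun ω => κ (θ ω) t)) :=
      Measurable.indicator ((κ.measurable_coe ht).comp hθ) hus
    have hg : Measurable[MeasurableSpace.comap v inferInstance]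
        ((v ⁻¹' w).indicator (1 : Ω → ENNReal)) :=
      (measurable_one.indicator hw).comp (comap_measurable v)
    rw [← lintegral_indicator_one (hv hw),
      ← lintegral_mul_eq_lintegral_mul_lintegral_of_independent_measurableSpace hh hv.comap_le hind
        hf hg]
    refine lintegral_congr fun ω => ?_
    rw [Set.inter_comm, ← Set.indicator_indicator]
    by_cases hω : ω ∈ v ⁻¹' w <;> simp [hω]
  have huY := hpart Set.univ MeasurableSet.univ
  simp only [Set.preimage_univ, Set.inter_univ, measure_univ, mul_one] at huY
  rw [Measure.map_apply ((hu0.prodMk hY).prodMk hv) ((hs.prod ht).prod hw), Measure.prod_prod,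
    Measure.map_apply (hu0.prodMk hY) (hs.prod ht), Measure.map_apply hv hw]
  have h1 : (fun ω => (u ω, Y ω)) ⁻¹' (s ×ˢ t) = u ⁻¹' s ∩ Y ⁻¹' t := rfl
  have h2 : (fun ω => ((u ω, Y ω), v ω)) ⁻¹' ((s ×ˢ t) ×ˢ w)
    = (u ⁻¹' s ∩ Y ⁻¹' t) ∩ v ⁻¹' w := rfl
  rw [h1, h2, hpart w hw, huY]

end ConditionalLaw

/-- Used with `u` the past and the sample, `x` the estimates and `z` a residual at the current time.
-/
theorem IndepFun.prodMk_left_of_prodMk_right {Ω U X Z : Type*} [MeasurableSpace Ω]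
    {P : Measure Ω} [IsProbabilityMeasure P]
    [MeasurableSpace U] [MeasurableSpace X] [MeasurableSpace Z] {u : Ω → U} {x : Ω → X} {z : Ω → Z}
    (hu : Measurable u) (hx : Measurable x) (hz : Measurable z)
    (h1 : IndepFun u (fun ω => (x ω, z ω)) P) (h2 : IndepFun x z P) :
    IndepFun (fun ω => (u ω, x ω)) z P := by
  have h3 : IndepFun u x P := h1.comp measurable_id measurable_fst
  rw [indepFun_iff_map_prod_eq_prod_map_map (by fun_prop) (by fun_prop)]
  refine Measure.ext_prod₃_iff'.2 fun {s t w} hs ht hw => ?_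
  rw [Measure.map_apply (by fun_prop) ((hs.prod ht).prod hw), Measure.prod_prod,
    Measure.map_apply (by fun_prop) (hs.prod ht), Measure.map_apply (by fun_prop) hw]
  have e1 : (fun ω => (u ω, x ω)) ⁻¹' (s ×ˢ t) = u ⁻¹' s ∩ x ⁻¹' t := rfl
  have e2 : (fun ω => ((u ω, x ω), z ω)) ⁻¹' ((s ×ˢ t) ×ˢ w)
    = u ⁻¹' s ∩ (fun ω => (x ω, z ω)) ⁻¹' (t ×ˢ w) := by
    ext ω; simp [and_assoc]
  have e3 : (fun ω => (x ω, z ω)) ⁻¹' (t ×ˢ w) = x ⁻¹' t ∩ z ⁻¹' w := rfl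
  rw [e1, e2, h1.measure_inter_preimage_eq_mul _ _ hs (ht.prod hw), e3,
    h2.measure_inter_preimage_eq_mul _ _ ht hw, h3.measure_inter_preimage_eq_mul _ _ hs ht,
    mul_assoc]

theorem IndepFun.of_map {Ω Ω' X Z : Type*} [MeasurableSpace Ω] [MeasurableSpace Ω']
    [MeasurableSpace X] [MeasurableSpace Z] {P : Measure Ω} {e : Ω → Ω'} {x : Ω' → X} {z : Ω' → Z}
    (he : Measurable e) (hx : Measurable x) (hz : Measurable z) (h : IndepFun x z (P.map e)) :
    IndepFun (fun ω => x (e ω)) (fun ω => z (e ω)) P := by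
  rw [indepFun_iff_measure_inter_preimage_eq_mul] at h ⊢
  intro s t hs ht
  have h1 := h s t hs ht
  rwa [Measure.map_apply he ((hx hs).inter (hz ht)), Measure.map_apply he (hx hs),
    Measure.map_apply he (hz ht)] at h1

theorem covariance_fst_add_snd_prod {Ω Ω' : Type*} [MeasurableSpace Ω] [MeasurableSpace Ω']
    {μ : Measure Ω} {ν : Measure Ω'} [IsProbabilityMeasure μ] [IsProbabilityMeasure ν]
    {a a' : Ω → ℝ} {b b' : Ω' → ℝ} (ha : MemLp a 2 μ) (ha' : MemLp a' 2 μ) (hb : MemLp b 2 ν)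
    (hb' : MemLp b' 2 ν) :
    cov[fun p => a p.1 + b p.2, fun p => a' p.1 + b' p.2; μ.prod ν]
      = cov[a, a'; μ] + cov[b, b'; ν] := by
  have h1 : MemLp (fun p : Ω × Ω' => a p.1) 2 (μ.prod ν) := ha.comp_fst ν
  have h1' : MemLp (fun p : Ω × Ω' => a' p.1) 2 (μ.prod ν) := ha'.comp_fst ν
  have h2 : MemLp (fun p : Ω × Ω' => b p.2) 2 (μ.prod ν) := hb.comp_snd μ
  have h2' : MemLp (fun p : Ω × Ω' => b' p.2) 2 (μ.prod ν) := hb'.comp_snd μ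
  have e1 : (fun p : Ω × Ω' => a p.1 + b p.2) = (fun p => a p.1) + fun p => b p.2 := rfl
  have e2 : (fun p : Ω × Ω' => a' p.1 + b' p.2) = (fun p => a' p.1) + fun p => b' p.2 := rfl
  rw [e1, e2, covariance_add_left h1 h2 (h1'.add h2'), covariance_add_right h1 h1' h2',
    covariance_add_right h2 h1' h2', covariance_fst_snd_prod ha hb',
    covariance_comm (fun p : Ω × Ω' => b p.2), covariance_fst_snd_prod ha' hb]
  have f1 := covariance_map_fun (X := a) (Y := a') (μ := μ.prod ν) (Z := Prod.fst)
    (by rw [measurePreserving_fst.map_eq]; exact ha.1)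
    (by rw [measurePreserving_fst.map_eq]; exact ha'.1) measurable_fst.aemeasurable
  have f2 := covariance_map_fun (X := b) (Y := b') (μ := μ.prod ν) (Z := Prod.snd)
    (by rw [measurePreserving_snd.map_eq]; exact hb.1)
    (by rw [measurePreserving_snd.map_eq]; exact hb'.1) measurable_snd.aemeasurable
  rw [measurePreserving_fst.map_eq] at f1
  rw [measurePreserving_snd.map_eq] at f2
  rw [← f1, ← f2]
  ring

/-! ### One arm: regression of the reward on the context estimate -/

namespace BanditModel

variable {d : ℕ} (M : BanditModel d)

/-- The law of the triple (context, output noise, reward noise) of one arm. -/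
noncomputable def envLaw :
    Measure (EuclideanSpace ℝ (Fin d) × EuclideanSpace ℝ (Fin d) × ℝ) :=
  (multivariateGaussian 0 M.covX).prod
    ((multivariateGaussian 0 M.covY).prod (gaussianReal 0 M.noiseVar))

instance : IsGaussian M.envLaw := by unfold envLaw; infer_instance

/-- The matrix `(Aᵀ Σ_y⁻¹ A + Σ_x⁻¹)⁻¹ Aᵀ Σ_y⁻¹` applied to the output. -/
noncomputable def gain : Matrix (Fin d) (Fin d) ℝ :=
  (M.Aᵀ * M.covY⁻¹ * M.A + M.covX⁻¹)⁻¹ * M.Aᵀ * M.covY⁻¹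

theorem isUnit_precision : IsUnit (M.Aᵀ * M.covY⁻¹ * M.A + M.covX⁻¹) := by
  have h := M.covY_posDef.inv.posSemidef.conjTranspose_mul_mul_same M.A
  rw [Matrix.conjTranspose_eq_transpose_of_trivial] at h
  exact (M.covX_posDef.inv.posSemidef_add h).isUnit

theorem isUnit_gain : IsUnit M.gain :=
  ((Matrix.isUnit_nonsing_inv_iff.2 M.isUnit_precision).mul
    ((Matrix.isUnit_transpose _).2 M.A_isUnit)).mul (Matrix.isUnit_nonsing_inv_iff.2 M.covY_posDef.isUnit)

/-- The push-through identity: the gain is `Σ_x Aᵀ (A Σ_x Aᵀ + Σ_y)⁻¹`, the coefficient of the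
regression of the context on the output. -/
theorem gain_mul : M.gain * (M.A * M.covX * M.Aᵀ + M.covY) = M.covX * M.Aᵀ := by
  have hy : M.covY⁻¹ * M.covY = 1 :=
    Matrix.nonsing_inv_mul _ ((Matrix.isUnit_iff_isUnit_det _).1 M.covY_posDef.isUnit)
  have hx : M.covX⁻¹ * M.covX = 1 :=
    Matrix.nonsing_inv_mul _ ((Matrix.isUnit_iff_isUnit_det _).1 M.covX_posDef.isUnit)
  have hL := Matrix.nonsing_inv_mul _ ((Matrix.isUnit_iff_isUnit_det _).1 M.isUnit_precision)
  have h : M.Aᵀ * M.covY⁻¹ * (M.A * M.covX * M.Aᵀ + M.covY)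
      = (M.Aᵀ * M.covY⁻¹ * M.A + M.covX⁻¹) * (M.covX * M.Aᵀ) := by
    simp only [mul_add, add_mul, mul_assoc, hy]
    rw [← mul_assoc M.covX⁻¹, hx]
    simp
  rw [gain, mul_assoc _ M.Aᵀ, mul_assoc _ (M.Aᵀ * _), h, ← mul_assoc, hL, one_mul]

/-- The left side is the covariance of `x̂` with `x`, the right side that of `x̂` with itself;
equality says that `x - x̂` is uncorrelated with `x̂`. -/
theorem gain_mul_A_mul_covX :
    M.gain * M.A * M.covX = M.gain * (M.A * M.covX * M.Aᵀ + M.covY) * M.gainᵀ := by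
  have hx : M.covXᵀ = M.covX := by
    rw [← Matrix.conjTranspose_eq_transpose_of_trivial]
    exact M.covX_posDef.isHermitian
  have hy : M.covYᵀ = M.covY := by
    rw [← Matrix.conjTranspose_eq_transpose_of_trivial]
    exact M.covY_posDef.isHermitian
  have h := congrArg Matrix.transpose (congrArg (· * M.gainᵀ) M.gain_mul)
  simp only [Matrix.transpose_mul, Matrix.transpose_transpose, Matrix.transpose_add, hx, hy] at h
  simp only [mul_assoc] at h ⊢
  exact h.symm

/-- The context estimate as a linear function of (context, output noise, reward noise). -/
noncomputable def estimate :
    EuclideanSpace ℝ (Fin d) × EuclideanSpace ℝ (Fin d) × ℝ →L[ℝ] EuclideanSpace ℝ (Fin d) :=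
  (Matrix.toEuclideanCLM (𝕜 := ℝ) M.gain).comp
    ((Matrix.toEuclideanCLM (𝕜 := ℝ) M.A).comp (ContinuousLinearMap.fst ℝ _ _) +
      (ContinuousLinearMap.fst ℝ _ _).comp (ContinuousLinearMap.snd ℝ _ _))

/-- The part of the reward that the context estimate does not explain. -/
noncomputable def residual : EuclideanSpace ℝ (Fin d) × EuclideanSpace ℝ (Fin d) × ℝ →L[ℝ] ℝ :=
  (innerSL ℝ M.muStar).comp (ContinuousLinearMap.fst ℝ _ _) +
    (ContinuousLinearMap.snd ℝ _ _).comp (ContinuousLinearMap.snd ℝ _ _) -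
    (innerSL ℝ M.muStar).comp M.estimate

variable {M}

theorem inner_toEuclideanCLM_right (G : Matrix (Fin d) (Fin d) ℝ) (u x : EuclideanSpace ℝ (Fin d)) :
    inner ℝ u (Matrix.toEuclideanCLM (𝕜 := ℝ) G x)
      = inner ℝ (Matrix.toEuclideanCLM (𝕜 := ℝ) Gᵀ u) x := by
  rw [← dotProduct_ofLp_eq_inner, ← dotProduct_ofLp_eq_inner]
  simp [Matrix.dotProduct_mulVec, Matrix.mulVec_transpose]

theorem inner_estimate (u : EuclideanSpace ℝ (Fin d))
    (e : EuclideanSpace ℝ (Fin d) × EuclideanSpace ℝ (Fin d) × ℝ) :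
    -- The term `0 * e.2.2` gives this functional the shape required by `covariance_linear_envLaw`.
    inner ℝ u (M.estimate e) = inner ℝ (Matrix.toEuclideanCLM (𝕜 := ℝ) (M.gain * M.A)ᵀ u) e.1
      + (inner ℝ (Matrix.toEuclideanCLM (𝕜 := ℝ) M.gainᵀ u) e.2.1 + 0 * e.2.2) := by
  simp only [estimate, ContinuousLinearMap.comp_apply, add_apply,
    ContinuousLinearMap.coe_fst', ContinuousLinearMap.coe_snd', map_add, inner_add_right,
    inner_toEuclideanCLM_right, Matrix.transpose_mul, map_mul, ContinuousLinearMap.mul_def]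
  ring

theorem residual_apply (e : EuclideanSpace ℝ (Fin d) × EuclideanSpace ℝ (Fin d) × ℝ) :
    M.residual e
      = inner ℝ (M.muStar - Matrix.toEuclideanCLM (𝕜 := ℝ) (M.gain * M.A)ᵀ M.muStar) e.1
      + (inner ℝ (- Matrix.toEuclideanCLM (𝕜 := ℝ) M.gainᵀ M.muStar) e.2.1 + 1 * e.2.2) := by
  simp only [residual, sub_apply, ContinuousLinearMap.comp_apply,
    add_apply,
    ContinuousLinearMap.coe_fst', ContinuousLinearMap.coe_snd', innerSL_apply_apply,
    inner_estimate, inner_sub_left, inner_neg_left]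
  ring

theorem covariance_inner_multivariateGaussian {S : Matrix (Fin d) (Fin d) ℝ} (hS : S.PosSemidef)
    (μ p q : EuclideanSpace ℝ (Fin d)) :
    cov[fun x => inner ℝ p x, fun x => inner ℝ q x; multivariateGaussian μ S]
      = inner ℝ p (Matrix.toEuclideanCLM (𝕜 := ℝ) S q) := by
  rw [← covarianceBilin_apply_eq_cov IsGaussian.memLp_two_id,
    covarianceBilin_multivariateGaussian hS, ← dotProduct_ofLp_eq_inner]
  rfl

theorem covariance_linear_envLaw (p q p' q' : EuclideanSpace ℝ (Fin d)) (s s' : ℝ) :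
    cov[fun e => inner ℝ p e.1 + (inner ℝ q e.2.1 + s * e.2.2),
      fun e => inner ℝ p' e.1 + (inner ℝ q' e.2.1 + s' * e.2.2); M.envLaw]
      = inner ℝ p (Matrix.toEuclideanCLM (𝕜 := ℝ) M.covX p')
        + (inner ℝ q (Matrix.toEuclideanCLM (𝕜 := ℝ) M.covY q')
          + cov[fun r => s * r, fun r => s' * r; gaussianReal 0 M.noiseVar]) := by
  have hm : ∀ (S : Matrix (Fin d) (Fin d) ℝ) (p : EuclideanSpace ℝ (Fin d)),
      MemLp (fun x => inner ℝ p x) 2 (multivariateGaussian 0 S) := fun S p =>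
    (innerSL ℝ p).comp_memLp' IsGaussian.memLp_two_id
  have hr : ∀ s : ℝ, MemLp (fun r : ℝ => s * r) 2 (gaussianReal 0 M.noiseVar) := fun s =>
    (IsGaussian.memLp_two_id (μ := gaussianReal 0 M.noiseVar)).const_mul s
  have h2 : ∀ (q : EuclideanSpace ℝ (Fin d)) (s : ℝ),
      MemLp (fun e : EuclideanSpace ℝ (Fin d) × ℝ => inner ℝ q e.1 + s * e.2) 2
        ((multivariateGaussian 0 M.covY).prod (gaussianReal 0 M.noiseVar)) := fun q s =>
    ((hm M.covY q).comp_fst _).add ((hr s).comp_snd _)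
  rw [envLaw, covariance_fst_add_snd_prod (hm _ p) (hm _ p') (h2 q s) (h2 q' s'),
    covariance_fst_add_snd_prod (hm _ q) (hm _ q') (hr s) (hr s'),
    covariance_inner_multivariateGaussian M.covX_posDef.posSemidef,
    covariance_inner_multivariateGaussian M.covY_posDef.posSemidef]

/-- Both are linear in one Gaussian vector, so zero covariance suffices. The reward noise does not
enter the estimate, and the remaining terms cancel by `gain_mul_A_mul_covX`. -/
theorem indepFun_estimate_residual : IndepFun M.estimate M.residual M.envLaw := by
  have hg : HasGaussianLaw (fun e => (M.estimate e, M.residual e)) M.envLaw :=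
    ⟨isGaussian_map (μ := M.envLaw) (M.estimate.prod M.residual)⟩
  refine hg.indepFun_of_covariance_inner fun u y => ?_
  have hy : (fun e => inner ℝ y (M.residual e)) = fun e => M.residual e * y := by
    funext e
    change M.residual e * y = _
    rfl
  rw [hy, covariance_mul_const_right]
  simp_rw [inner_estimate]
  rw [show ⇑M.residual = _ from funext residual_apply, covariance_linear_envLaw]
  have h0 : cov[fun r => (0 : ℝ) * r, fun r => 1 * r; gaussianReal 0 M.noiseVar] = 0 := by
    rw [covariance_const_mul_left, zero_mul]
  rw [h0, ← inner_toEuclideanCLM_right, ← inner_toEuclideanCLM_right]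
  have h := congrArg (fun G => inner ℝ u (Matrix.toEuclideanCLM (𝕜 := ℝ) G M.muStar))
    M.gain_mul_A_mul_covX
  simp only [mul_add, add_mul, map_add, map_mul, ContinuousLinearMap.mul_def,
    ContinuousLinearMap.comp_apply, add_apply, inner_add_right, Matrix.transpose_mul, map_sub, map_neg,
    inner_sub_right, inner_neg_right] at h ⊢
  rw [h]
  ring

theorem integral_residual : ∫ e, M.residual e ∂M.envLaw = 0 := by
  rw [IsGaussian.integral_dual M.residual]
  have : ∫ e, e ∂M.envLaw = 0 := by
    have hi : Integrable (fun e => e) M.envLaw := IsGaussian.integrable_id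
    have hi2 : Integrable (fun e => e)
        ((multivariateGaussian 0 M.covY).prod (gaussianReal 0 M.noiseVar)) :=
      IsGaussian.integrable_id
    have h2 : ∫ e, e ∂((multivariateGaussian 0 M.covY).prod (gaussianReal 0 M.noiseVar)) = 0 := by
      refine Prod.ext ?_ ?_
      · rw [fst_integral hi2, integral_fun_fst (fun x => x)]
        simp
      · rw [snd_integral hi2, integral_fun_snd (fun x => x)]
        simp
    refine Prod.ext ?_ ?_
    · rw [fst_integral hi, envLaw, integral_fun_fst (fun x => x)]
      simp
    · rw [snd_integral hi, envLaw, integral_fun_snd (fun x => x), h2]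
      simp
  rw [this, map_zero]

/-- A real Gaussian law of positive variance has no atoms. Positivity already comes from the output
noise, since `Σ_y` is positive definite and the gain is invertible; the latter rests on the
invertibility of `A`. -/
theorem envLaw_inner_estimate_eq {u : EuclideanSpace ℝ (Fin d)} (hu : u ≠ 0) :
    NullSingletonClass (M.envLaw.map fun e => inner ℝ u (M.estimate e)) := by
  have h : (fun e => inner ℝ u (M.estimate e)) = ((innerSL ℝ u).comp M.estimate) := rfl
  rw [h, IsGaussian.map_eq_gaussianReal]
  refine nullSingletonClass_gaussianReal ?_
  simp only [ne_eq, Real.toNNReal_eq_zero, not_le]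
  rw [← h]
  simp_rw [inner_estimate]
  rw [← covariance_self (by fun_prop), covariance_linear_envLaw]
  have h0 : cov[fun r => (0 : ℝ) * r, fun r => 0 * r; gaussianReal 0 M.noiseVar] = 0 := by
    rw [covariance_const_mul_left, zero_mul]
  rw [h0, add_zero, ← dotProduct_ofLp_eq_inner, ← dotProduct_ofLp_eq_inner]
  refine add_pos_of_nonneg_of_pos (M.covX_posDef.posSemidef.dotProduct_mulVec_nonneg _)
    (M.covY_posDef.dotProduct_mulVec_pos ?_)
  intro h1
  have h2 : M.gainᵀ *ᵥ u.ofLp = M.gainᵀ *ᵥ 0 := by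
    rw [Matrix.mulVec_zero]
    exact h1
  have h3 := Matrix.mulVec_injective_of_isUnit ((Matrix.isUnit_transpose _).2 M.isUnit_gain) h2
  exact hu (WithLp.ofLp_injective 2 h3)

end BanditModel

/-! ### All arms together: ties are null and the estimates are well spread -/

namespace BanditModel

variable {d : ℕ} (M : BanditModel d) (N : ℕ)

/-- The joint law of (context, output noise, reward noise) over all arms. -/
noncomputable def jointLaw :
    Measure (Fin N → EuclideanSpace ℝ (Fin d) × EuclideanSpace ℝ (Fin d) × ℝ) :=
  Measure.pi fun _ => M.envLaw

instance : IsProbabilityMeasure (M.jointLaw N) := by unfold jointLaw; infer_instance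

variable {M N}

theorem measurePreserving_eval_jointLaw (i : Fin N) :
    MeasurePreserving (fun e => e i) (M.jointLaw N) M.envLaw :=
  measurePreserving_eval (fun _ : Fin N => M.envLaw) i

theorem measurable_estimate_pi : Measurable fun (e : Fin N → _) j => M.estimate (e j) :=
  measurable_pi_lambda _ fun j => M.estimate.continuous.measurable.comp (measurable_pi_apply j)

theorem measurable_residual_pi : Measurable fun (e : Fin N → _) j => M.residual (e j) :=
  measurable_pi_lambda _ fun j => M.residual.continuous.measurable.comp (measurable_pi_apply j)

/-- A product over arms of product laws (estimate times residual) regroups into the law of all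
estimates times the law of all residuals. -/
theorem indepFun_estimate_residual_jointLaw :
    IndepFun (fun e (j : Fin N) => M.estimate (e j)) (fun e j => M.residual (e j))
      (M.jointLaw N) := by
  have hpair : M.envLaw.map (fun e => (M.estimate e, M.residual e))
      = (M.envLaw.map M.estimate).prod (M.envLaw.map M.residual) :=
    (indepFun_iff_map_prod_eq_prod_map_map (by fun_prop) (by fun_prop)).1 indepFun_estimate_residual
  have hE : IsProbabilityMeasure (M.envLaw.map M.estimate) :=
    Measure.isProbabilityMeasure_map (by fun_prop)
  have hR : IsProbabilityMeasure (M.envLaw.map M.residual) :=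
    Measure.isProbabilityMeasure_map (by fun_prop)
  have hER : IsProbabilityMeasure (M.envLaw.map (fun e => (M.estimate e, M.residual e))) :=
    Measure.isProbabilityMeasure_map (by fun_prop)
  rw [indepFun_iff_map_prod_eq_prod_map_map measurable_estimate_pi.aemeasurable
      measurable_residual_pi.aemeasurable, jointLaw,
    Measure.pi_map_pi (fun _ => by fun_prop), Measure.pi_map_pi (fun _ => by fun_prop),
    ← (measurePreserving_arrowProdEquivProdArrow _ _ (Fin N) (fun _ => M.envLaw.map M.estimate)
      (fun _ => M.envLaw.map M.residual)).map_eq, ← hpair,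
    ← Measure.pi_map_pi (fun _ => by fun_prop), Measure.map_map (by fun_prop) (by fun_prop)]
  rfl

theorem jointLaw_inner_estimate_eq_zero {u : EuclideanSpace ℝ (Fin d)} (hu : u ≠ 0) (i : Fin N) :
    M.jointLaw N {e | inner ℝ u (M.estimate (e i)) = 0} = 0 := by
  have := envLaw_inner_estimate_eq (M := M) hu
  have h1 : MeasurableSet {e | inner ℝ u (M.estimate e) = 0} :=
    (measurableSet_singleton (0 : ℝ)).preimage (by fun_prop :
      Measurable fun e => inner ℝ u (M.estimate e))
  have h2 := (measurePreserving_eval_jointLaw (M := M) i).measure_preimage h1.nullMeasurableSet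
  refine h2.trans ?_
  have h3 : (M.envLaw.map fun e => inner ℝ u (M.estimate e)) {0} = 0 := measure_singleton _
  rwa [Measure.map_apply (by fun_prop) (measurableSet_singleton _)] at h3

theorem jointLaw_inner_estimate_eq {u : EuclideanSpace ℝ (Fin d)} (hu : u ≠ 0) {i j : Fin N}
    (hij : i ≠ j) :
    M.jointLaw N {e | inner ℝ u (M.estimate (e i)) = inner ℝ u (M.estimate (e j))} = 0 := by
  have hna := envLaw_inner_estimate_eq (M := M) hu
  set f : EuclideanSpace ℝ (Fin d) × EuclideanSpace ℝ (Fin d) × ℝ → ℝ :=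
    fun e => inner ℝ u (M.estimate e) with hf
  have hfm : Measurable f := by fun_prop
  have hind : IndepFun (fun e : Fin N → _ => f (e i)) (fun e => f (e j)) (M.jointLaw N) :=
    (iIndepFun_pi (X := fun _ : Fin N => f) (μ := fun _ => M.envLaw)
      fun _ => hfm.aemeasurable).indepFun hij
  have hmap : ∀ k : Fin N, (M.jointLaw N).map (fun e => f (e k)) = M.envLaw.map f := fun k => by
    rw [← (measurePreserving_eval_jointLaw (M := M) k).map_eq, Measure.map_map hfm (by fun_prop)]
    rfl
  have hmi : ∀ k : Fin N, Measurable fun e : Fin N →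
      EuclideanSpace ℝ (Fin d) × EuclideanSpace ℝ (Fin d) × ℝ => f (e k) := fun k =>
    hfm.comp (measurable_pi_apply k)
  have hprod := (indepFun_iff_map_prod_eq_prod_map_map (hmi i).aemeasurable
    (hmi j).aemeasurable).1 hind
  rw [hmap, hmap] at hprod
  have hP : IsProbabilityMeasure (M.envLaw.map f) := Measure.isProbabilityMeasure_map hfm.aemeasurable
  have hD : MeasurableSet {p : ℝ × ℝ | p.1 = p.2} := measurableSet_eq_fun measurable_fst measurable_snd
  have h0 : (M.envLaw.map f).prod (M.envLaw.map f) {p : ℝ × ℝ | p.1 = p.2} = 0 := by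
    rw [Measure.measure_prod_null hD]
    refine ae_of_all _ fun x => ?_
    have : Prod.mk x ⁻¹' {p : ℝ × ℝ | p.1 = p.2} = {x} := by
      ext y; simp [eq_comm]
    change M.envLaw.map f (Prod.mk x ⁻¹' {p : ℝ × ℝ | p.1 = p.2}) = 0
    rw [this]
    exact measure_singleton _
  rwa [← hprod, Measure.map_apply ((hmi i).prodMk (hmi j)) hD] at h0

/-- Outcomes for which all context estimates are bounded by `n + 1` and their components along `u`
are at least `2 / (n + 1)`. -/
def wellSpread (M : BanditModel d) (N : ℕ) (u : EuclideanSpace ℝ (Fin d)) (n : ℕ) :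
    Set (Fin N → EuclideanSpace ℝ (Fin d) × EuclideanSpace ℝ (Fin d) × ℝ) :=
  {e | ∀ i, 2 / ((n : ℝ) + 1) ≤ |inner ℝ u (M.estimate (e i))| ∧ ‖M.estimate (e i)‖ ≤ n + 1}

theorem measurableSet_wellSpread (u : EuclideanSpace ℝ (Fin d)) (n : ℕ) :
    MeasurableSet (wellSpread M N u n) := by
  have : wellSpread M N u n = ⋂ i, {e | 2 / ((n : ℝ) + 1) ≤ |inner ℝ u (M.estimate (e i))|} ∩
      {e | ‖M.estimate (e i)‖ ≤ n + 1} := by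
    ext e; simp [wellSpread]
  rw [this]
  refine MeasurableSet.iInter fun i => (measurableSet_le measurable_const ?_).inter
    (measurableSet_le ?_ measurable_const)
  · have : Measurable fun e : Fin N → EuclideanSpace ℝ (Fin d) × EuclideanSpace ℝ (Fin d) × ℝ =>
        (inner ℝ u (M.estimate (e i)) : ℝ) := by fun_prop
    exact this.abs
  · fun_prop

/-- The sets increase with `n` and exhaust the space up to a null set, because no component along
`u` vanishes. -/
theorem exists_three_quarters_le_jointLaw_wellSpread {u : EuclideanSpace ℝ (Fin d)} (hu : u ≠ 0) :
    ∃ n, 3 / 4 ≤ M.jointLaw N (wellSpread M N u n) := by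
  have hmono : Monotone (wellSpread M N u) := fun m n hmn e he i => by
    have hmn' : (m : ℝ) ≤ n := by exact_mod_cast hmn
    refine ⟨le_trans ?_ (he i).1, (he i).2.trans (by linarith)⟩
    gcongr
  have hae : ∀ᵐ e ∂(M.jointLaw N), e ∈ ⋃ n, wellSpread M N u n := by
    have h0 : ∀ i, ∀ᵐ e ∂(M.jointLaw N), inner ℝ u (M.estimate (e i)) ≠ 0 := fun i =>
      measure_eq_zero_iff_ae_notMem.1 (jointLaw_inner_estimate_eq_zero hu i)
    filter_upwards [ae_all_iff.2 h0] with e he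
    have hlim : Tendsto (fun n : ℕ => 2 / ((n : ℝ) + 1)) atTop (𝓝 0) := by
      have := (tendsto_one_div_add_atTop_nhds_zero_nat (𝕜 := ℝ)).const_mul 2
      simpa [div_eq_mul_inv] using this
    have hev : ∀ᶠ n : ℕ in atTop, e ∈ wellSpread M N u n := by
      refine eventually_all.2 fun i => ?_
      filter_upwards [hlim.eventually (ge_mem_nhds (abs_pos.2 (he i))),
        (tendsto_natCast_atTop_atTop (R := ℝ)).eventually_ge_atTop ‖M.estimate (e i)‖] with n h1 h2
      exact ⟨h1, h2.trans (by linarith)⟩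
    obtain ⟨n, hn⟩ := hev.exists
    exact Set.mem_iUnion.2 ⟨n, hn⟩
  have hone : M.jointLaw N (⋃ n, wellSpread M N u n) = 1 := prob_compl_eq_zero_iff
    (MeasurableSet.iUnion fun n => measurableSet_wellSpread u n) |>.1 hae
  have ht := tendsto_measure_iUnion_atTop (μ := M.jointLaw N) hmono
  rw [hone] at ht
  obtain ⟨n, hn⟩ := (ht.eventually (le_mem_nhds (a := 3 / 4) (by
    rw [ENNReal.div_lt_iff (by simp) (by simp)]; norm_num))).exists
  exact ⟨n, hn⟩

/-- Requiring all arms to be spread makes the bound valid for whichever arm is chosen. Moving the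
direction by less than `1/(n+1)²` changes a component by at most `1/(n+1)`, since estimates are
bounded by `n + 1`; half of the margin `2/(n+1)` remains, and finitely many directions suffice. -/
theorem exists_finite_wellSpread_cover (M : BanditModel d) (N : ℕ) :
    ∃ (s : Finset (EuclideanSpace ℝ (Fin d)))
      (G : EuclideanSpace ℝ (Fin d) →
        Set (Fin N → EuclideanSpace ℝ (Fin d) × EuclideanSpace ℝ (Fin d) × ℝ)) (η : ℝ),
      0 < η ∧ (∀ k ∈ s, MeasurableSet (G k)) ∧ (∀ k ∈ s, 3 / 4 ≤ M.jointLaw N (G k)) ∧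
      ∀ u : EuclideanSpace ℝ (Fin d), ‖u‖ = 1 → ∃ k ∈ s, ∀ e ∈ G k, ∀ i,
        η ≤ |inner ℝ u (M.estimate (e i))| := by
  classical
  have hne : ∀ u : EuclideanSpace ℝ (Fin d), u ∈ Metric.sphere (0 : EuclideanSpace ℝ (Fin d)) 1 →
      u ≠ 0 := fun u hu => by
    rintro rfl
    simp at hu
  choose! n hn using fun (u : EuclideanSpace ℝ (Fin d))
    (hu : u ∈ Metric.sphere (0 : EuclideanSpace ℝ (Fin d)) 1) =>
      exists_three_quarters_le_jointLaw_wellSpread (M := M) (N := N) (hne u hu)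
  obtain ⟨s, hs, hcov⟩ := (isCompact_sphere (0 : EuclideanSpace ℝ (Fin d)) 1).elim_nhds_subcover
    (fun u => Metric.ball u (1 / ((n u : ℝ) + 1) ^ 2))
    fun u _ => Metric.ball_mem_nhds _ (by positivity)
  refine ⟨s, fun k => wellSpread M N k (n k), 1 / (((s.sup n : ℕ) : ℝ) + 1), by positivity,
    fun k _ => measurableSet_wellSpread k _, fun k hk => hn k (hs k hk), fun u hu => ?_⟩
  obtain ⟨k, hk, huk⟩ := Set.mem_iUnion₂.1 (hcov (by simpa using hu))
  refine ⟨k, hk, fun e he i => ?_⟩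
  obtain ⟨h1, h2⟩ := he i
  have hle : (n k : ℝ) ≤ (s.sup n : ℕ) := by exact_mod_cast Finset.le_sup (f := n) hk
  have h3 : |inner ℝ (k - u) (M.estimate (e i))| ≤ 1 / ((n k : ℝ) + 1) := by
    refine (abs_real_inner_le_norm _ _).trans ?_
    rw [Metric.mem_ball', dist_eq_norm] at huk
    calc _ ≤ 1 / ((n k : ℝ) + 1) ^ 2 * ((n k : ℝ) + 1) := by gcongr
      _ = _ := by field_simp
  rw [inner_sub_left] at h3
  have h4 := abs_sub_abs_le_abs_sub (inner ℝ k (M.estimate (e i))) (inner ℝ u (M.estimate (e i)))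
  calc 1 / (((s.sup n : ℕ) : ℝ) + 1) ≤ 1 / ((n k : ℝ) + 1) := by gcongr
    _ = 2 / ((n k : ℝ) + 1) - 1 / ((n k : ℝ) + 1) := by ring
    _ ≤ _ := by linarith

end BanditModel

/-- Take the minimum of the quadratic form on the unit sphere, then rescale; for `d = 0` the sphere
is empty and any constant works. -/
theorem Matrix.PosDef.exists_coercive {d : ℕ} {T : Matrix (Fin d) (Fin d) ℝ} (hT : T.PosDef) :
    ∃ b : ℝ, 0 < b ∧ ∀ u : EuclideanSpace ℝ (Fin d), b * ‖u‖ ^ 2 ≤ u.ofLp ⬝ᵥ (T *ᵥ u.ofLp) := by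
  have hcont : Continuous fun u : EuclideanSpace ℝ (Fin d) => u.ofLp ⬝ᵥ (T *ᵥ u.ofLp) := by
    fun_prop
  obtain ⟨b, hb, h⟩ : ∃ b : ℝ, 0 < b ∧
      ∀ u : EuclideanSpace ℝ (Fin d), ‖u‖ = 1 → b ≤ u.ofLp ⬝ᵥ (T *ᵥ u.ofLp) := by
    rcases (Metric.sphere (0 : EuclideanSpace ℝ (Fin d)) 1).eq_empty_or_nonempty with he | hne
    · refine ⟨1, one_pos, fun u hu => ?_⟩
      have : u ∈ Metric.sphere (0 : EuclideanSpace ℝ (Fin d)) 1 := by simpa using hu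
      simp [he] at this
    · obtain ⟨v, hv, hmin⟩ := (isCompact_sphere _ _).exists_isMinOn hne hcont.continuousOn
      refine ⟨_, hT.dotProduct_mulVec_pos (x := v.ofLp) ?_, fun u hu => hmin (by simpa using hu)⟩
      intro h0
      have : v = 0 := WithLp.ofLp_injective 2 h0
      simp [this] at hv
  refine ⟨b, hb, fun u => ?_⟩
  rcases eq_or_ne u 0 with rfl | hu
  · simp
  have hn : ‖u‖ ≠ 0 := norm_ne_zero_iff.2 hu
  have h1 := h (‖u‖⁻¹ • u) (by rw [norm_smul, norm_inv, norm_norm, inv_mul_cancel₀ hn])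
  simp only [WithLp.ofLp_smul, Matrix.mulVec_smul, dotProduct_smul, smul_dotProduct,
    smul_eq_mul] at h1
  calc b * ‖u‖ ^ 2 ≤ (‖u‖⁻¹ * (‖u‖⁻¹ * (u.ofLp ⬝ᵥ (T *ᵥ u.ofLp)))) * ‖u‖ ^ 2 := by gcongr
    _ = _ := by field_simp

theorem measurable_matrix_inv_apply {d : ℕ} (i j : Fin d) :
    Measurable fun p : Fin d → Fin d → ℝ => (Matrix.of p)⁻¹ i j := by
  have hof : Continuous fun p : Fin d → Fin d → ℝ => Matrix.of p := continuous_id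
  have h : (fun p : Fin d → Fin d → ℝ => (Matrix.of p)⁻¹ i j)
      = fun p => ((Matrix.of p).det)⁻¹ * (Matrix.of p).adjugate i j := by
    funext p
    rw [Matrix.inv_def]
    simp
  rw [h]
  have h1 : Continuous fun p : Fin d → Fin d → ℝ => (Matrix.of p).det := hof.matrix_det
  have h2 : Continuous fun p : Fin d → Fin d → ℝ => (Matrix.of p).adjugate i j :=
    hof.matrix_adjugate.matrix_elem i j
  exact h1.measurable.inv.mul h2.measurable

/-! ### The posterior as ridge regression: error formula, measurability, visit counts -/

namespace BanditRun

variable {Ω : Type*} {d N : ℕ} {R : BanditRun Ω d N} {M : BanditModel d}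

theorem xhat_eq_estimate (t : ℕ) (i : Fin N) (ω : Ω) :
    R.xhat M t i ω = M.estimate (R.env t ω i) := rfl

theorem chosenXhat_eq_estimate (t : ℕ) (ω : Ω) :
    R.chosenXhat M t ω = M.estimate (R.env t ω (R.arm t ω)) := xhat_eq_estimate t _ ω

theorem reward_eq (t : ℕ) (i : Fin N) (ω : Ω) :
    R.reward M t i ω = inner ℝ (R.xhat M t i ω) M.muStar + M.residual (R.env t ω i) := by
  simp only [reward, xhat_eq_estimate, BanditModel.residual, sub_apply, add_apply,
    ContinuousLinearMap.comp_apply, ContinuousLinearMap.coe_fst', ContinuousLinearMap.coe_snd',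
    innerSL_apply_apply, env, real_inner_comm M.muStar]
  ring

/-- The unexplained part of the observed reward times the estimated context. -/
noncomputable def score (R : BanditRun Ω d N) (M : BanditModel d) (t : ℕ) (ω : Ω) :
    EuclideanSpace ℝ (Fin d) :=
  M.residual (R.env t ω (R.arm t ω)) • R.chosenXhat M t ω

/-- The parameters `(μ̂(t), B(t)⁻¹)` of the posterior. -/
noncomputable def posterior (R : BanditRun Ω d N) (M : BanditModel d) (t : ℕ) (ω : Ω) :
    EuclideanSpace ℝ (Fin d) × (Fin d → Fin d → ℝ) :=
  (R.muHat M t ω, fun i j => (R.B M t ω)⁻¹ i j)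

theorem dotProduct_B_mulVec (t : ℕ) (ω : Ω) (u : EuclideanSpace ℝ (Fin d)) :
    u.ofLp ⬝ᵥ (R.B M t ω *ᵥ u.ofLp) = u.ofLp ⬝ᵥ (M.prior⁻¹ *ᵥ u.ofLp)
      + ∑ τ ∈ Finset.Ico 1 t, inner ℝ u (R.chosenXhat M τ ω) ^ 2 := by
  rw [B, Matrix.add_mulVec, dotProduct_add, Matrix.sum_mulVec, dotProduct_sum]
  congr 1
  refine Finset.sum_congr rfl fun τ _ => ?_
  rw [Matrix.vecMulVec_mulVec, ← dotProduct_ofLp_eq_inner]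
  simp [dotProduct_comm, sq]

theorem posDef_B (t : ℕ) (ω : Ω) : (R.B M t ω).PosDef := by
  refine M.prior_posDef.inv.add_posSemidef (Matrix.posSemidef_sum _ fun τ _ => ?_)
  simpa using Matrix.posSemidef_vecMulVec_self_star (R.chosenXhat M τ ω).ofLp

/-- Substituting the regression form of the reward produces `B(t) μ_*` except for the prior term,
which is the bias. -/
theorem muHat_sub_muStar (t : ℕ) (ω : Ω) :
    R.muHat M t ω - M.muStar = Matrix.toEuclideanCLM (𝕜 := ℝ) (R.B M t ω)⁻¹
      (∑ τ ∈ Finset.Ico 1 t, R.score M τ ω - Matrix.toEuclideanCLM (𝕜 := ℝ) M.prior⁻¹ M.muStar) := by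
  have hinv : (R.B M t ω)⁻¹ * R.B M t ω = 1 :=
    Matrix.nonsing_inv_mul _ ((Matrix.isUnit_iff_isUnit_det _).1 (posDef_B t ω).isUnit)
  have hsum : ∑ τ ∈ Finset.Ico 1 t, R.chosenReward M τ ω • R.chosenXhat M τ ω
      = Matrix.toEuclideanCLM (𝕜 := ℝ) (R.B M t ω) M.muStar
        + (∑ τ ∈ Finset.Ico 1 t, R.score M τ ω
          - Matrix.toEuclideanCLM (𝕜 := ℝ) M.prior⁻¹ M.muStar) := by
    have hB : Matrix.toEuclideanCLM (𝕜 := ℝ) (R.B M t ω) M.muStar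
        = Matrix.toEuclideanCLM (𝕜 := ℝ) M.prior⁻¹ M.muStar
          + ∑ τ ∈ Finset.Ico 1 t, (inner ℝ (R.chosenXhat M τ ω) M.muStar : ℝ) •
            R.chosenXhat M τ ω := by
      rw [B, map_add, map_sum, add_apply, sum_apply]
      congr 1
      refine Finset.sum_congr rfl fun τ _ => ?_
      refine WithLp.ofLp_injective 2 ?_
      simp [Matrix.vecMulVec_mulVec, dotProduct_ofLp_eq_inner]
    rw [hB]
    have : ∀ τ, R.chosenReward M τ ω • R.chosenXhat M τ ω
        = (inner ℝ (R.chosenXhat M τ ω) M.muStar : ℝ) • R.chosenXhat M τ ω + R.score M τ ω :=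
      fun τ => by rw [chosenReward, reward_eq, add_smul]; rfl
    simp only [this, Finset.sum_add_distrib]
    abel
  have hmu : R.muHat M t ω = Matrix.toEuclideanCLM (𝕜 := ℝ) (R.B M t ω)⁻¹
      (∑ τ ∈ Finset.Ico 1 t, R.chosenReward M τ ω • R.chosenXhat M τ ω) := rfl
  rw [hmu, hsum, map_add, ← ContinuousLinearMap.comp_apply, ← ContinuousLinearMap.mul_def, ← map_mul,
    hinv, map_one]
  simp

theorem norm_muHat_sub_muStar_le (t : ℕ) (ω : Ω) :
    ‖R.muHat M t ω - M.muStar‖ ≤ ‖(R.B M t ω)⁻¹‖ * (‖∑ τ ∈ Finset.Ico 1 t, R.score M τ ω‖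
      + ‖Matrix.toEuclideanCLM (𝕜 := ℝ) M.prior⁻¹ M.muStar‖) := by
  rw [muHat_sub_muStar]
  refine (ContinuousLinearMap.le_opNorm _ _).trans ?_
  rw [Matrix.l2_opNorm_def]
  exact mul_le_mul_of_nonneg_left (norm_sub_le _ _) (norm_nonneg _)

section Measurability

variable [MeasurableSpace Ω]

theorem measurable_chosenXhat {t : ℕ} (he : Measurable (R.env t)) (ha : Measurable (R.arm t)) :
    Measurable (R.chosenXhat M t) := by
  have h : Measurable fun p : (Fin N → EuclideanSpace ℝ (Fin d) × EuclideanSpace ℝ (Fin d) × ℝ) ×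
      Fin N => M.estimate (p.1 p.2) :=
    measurable_from_prod_countable_left fun i =>
      M.estimate.continuous.measurable.comp (measurable_pi_apply i)
  have h2 := h.comp (he.prodMk ha)
  simp only [Function.comp_def] at h2
  rwa [show R.chosenXhat M t = _ from funext (chosenXhat_eq_estimate t)]

theorem measurable_score {t : ℕ} (he : Measurable (R.env t)) (ha : Measurable (R.arm t)) :
    Measurable (R.score M t) := by
  have h : Measurable fun p : (Fin N → EuclideanSpace ℝ (Fin d) × EuclideanSpace ℝ (Fin d) × ℝ) ×
      Fin N => M.residual (p.1 p.2) :=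
    measurable_from_prod_countable_left fun i =>
      M.residual.continuous.measurable.comp (measurable_pi_apply i)
  exact (h.comp (he.prodMk ha)).smul (measurable_chosenXhat he ha)

theorem measurable_chosenReward {t : ℕ} (he : Measurable (R.env t)) (ha : Measurable (R.arm t)) :
    Measurable (R.chosenReward M t) := by
  have h : Measurable fun p : (Fin N → EuclideanSpace ℝ (Fin d) × EuclideanSpace ℝ (Fin d) × ℝ) ×
      Fin N => (inner ℝ (p.1 p.2).1 M.muStar : ℝ) + (p.1 p.2).2.2 :=
    measurable_from_prod_countable_left fun i => by fun_prop
  exact h.comp (he.prodMk ha)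

theorem measurable_posterior {t : ℕ} (he : ∀ τ ∈ Finset.Ico 1 t, Measurable (R.env τ))
    (ha : ∀ τ ∈ Finset.Ico 1 t, Measurable (R.arm τ)) : Measurable (R.posterior M t) := by
  have hx : ∀ τ ∈ Finset.Ico 1 t, Measurable (R.chosenXhat M τ) := fun τ hτ =>
    measurable_chosenXhat (he τ hτ) (ha τ hτ)
  have hB : Measurable fun ω (i j : Fin d) => R.B M t ω i j := by
    refine measurable_pi_lambda _ fun i => measurable_pi_lambda _ fun j => ?_
    have : (fun ω => R.B M t ω i j) = fun ω => M.prior⁻¹ i j +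
        ∑ τ ∈ Finset.Ico 1 t, R.chosenXhat M τ ω i * R.chosenXhat M τ ω j := by
      funext ω
      simp [B, Matrix.sum_apply, Matrix.vecMulVec_apply]
    rw [this]
    refine measurable_const.add (Finset.measurable_fun_sum _ fun τ hτ => ?_)
    have h := hx τ hτ
    have hc : ∀ i : Fin d, Measurable fun ω => R.chosenXhat M τ ω i := fun i =>
      (measurable_pi_apply i).comp ((WithLp.measurable_ofLp 2 (Fin d → ℝ)).comp h)
    exact (hc i).mul (hc j)
  have hBinv : ∀ i j, Measurable fun ω => (R.B M t ω)⁻¹ i j := fun i j =>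
    (measurable_matrix_inv_apply i j).comp hB
  have hsum : Measurable fun ω => ∑ τ ∈ Finset.Ico 1 t,
      R.chosenReward M τ ω • R.chosenXhat M τ ω :=
    Finset.measurable_fun_sum _ fun τ hτ =>
      (measurable_chosenReward (he τ hτ) (ha τ hτ)).smul (hx τ hτ)
  refine Measurable.prodMk ?_ (measurable_pi_lambda _ fun i => measurable_pi_lambda _ fun j =>
    hBinv i j)
  refine (WithLp.measurable_toLp 2 (Fin d → ℝ)).comp (measurable_pi_lambda _ fun i => ?_)
  change Measurable fun ω => ∑ j, (R.B M t ω)⁻¹ i j *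
    (∑ τ ∈ Finset.Ico 1 t, R.chosenReward M τ ω • R.chosenXhat M τ ω).ofLp j
  refine Finset.measurable_fun_sum _ fun j _ => (hBinv i j).mul ?_
  exact (measurable_pi_apply j).comp ((WithLp.measurable_ofLp 2 (Fin d → ℝ)).comp hsum)

end Measurability

theorem measurable_env_history {τ t : ℕ} (h : τ ∈ Finset.Ico 1 t) :
    Measurable[R.history t] (R.env τ) :=
  measurable_iff_comap_le.2 ((le_sup_left.trans le_sup_left).trans (le_iSup₂_of_le τ h le_rfl))

theorem measurable_arm_history {τ t : ℕ} (h : τ ∈ Finset.Ico 1 t) :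
    Measurable[R.history t] (R.arm τ) :=
  measurable_iff_comap_le.2 (le_sup_right.trans (le_iSup₂_of_le τ h le_rfl))

theorem measurable_posterior_history (t : ℕ) : Measurable[R.history t] (R.posterior M t) :=
  -- The general measurability lemma, with the history in the role of the ambient σ-algebra.
  @measurable_posterior Ω d N R M (R.history t) t (fun _ h => measurable_env_history h)
    (fun _ h => measurable_arm_history h)

theorem measurable_score_history {τ t : ℕ} (h : τ ∈ Finset.Ico 1 t) :
    Measurable[R.history t] (R.score M τ) :=
  @measurable_score Ω d N R M (R.history t) τ (measurable_env_history h) (measurable_arm_history h)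

open scoped Classical in
/-- The weight of an outcome in the exponential count of visits to `G`. -/
noncomputable def visitWeight
    (G : Set (Fin N → EuclideanSpace ℝ (Fin d) × EuclideanSpace ℝ (Fin d) × ℝ))
    (e : Fin N → EuclideanSpace ℝ (Fin d) × EuclideanSpace ℝ (Fin d) × ℝ) : ENNReal :=
  if e ∈ G then 2⁻¹ ^ 4 else 1

/-- Runs that visit `G` rarely in the first `n` steps. -/
def rarelyVisits (R : BanditRun Ω d N)
    (G : Set (Fin N → EuclideanSpace ℝ (Fin d) × EuclideanSpace ℝ (Fin d) × ℝ)) (n : ℕ) : Set Ω :=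
  {ω | 2⁻¹ ^ n ≤ ∏ τ ∈ Finset.Ico 1 (n + 1), visitWeight G (R.env τ ω)}

theorem le_sum_sq_of_notMem_rarelyVisits
    {G : Set (Fin N → EuclideanSpace ℝ (Fin d) × EuclideanSpace ℝ (Fin d) × ℝ)} {n : ℕ} {ω : Ω}
    (hω : ω ∉ R.rarelyVisits G n) {u : EuclideanSpace ℝ (Fin d)} {η : ℝ} (hη : 0 < η)
    (hG : ∀ e ∈ G, ∀ i, η ≤ |inner ℝ u (M.estimate (e i))|) :
    η ^ 2 * (n / 4) ≤ ∑ τ ∈ Finset.Ico 1 (n + 1), inner ℝ u (R.chosenXhat M τ ω) ^ 2 := by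
  classical
  set c := ((Finset.Ico 1 (n + 1)).filter fun τ => R.env τ ω ∈ G) with hc
  have hprod : ∏ τ ∈ Finset.Ico 1 (n + 1), visitWeight G (R.env τ ω) = 2⁻¹ ^ (4 * c.card) := by
    simp only [visitWeight]
    rw [Finset.prod_ite, Finset.prod_const, Finset.prod_const_one, mul_one, pow_mul, hc]
  -- Each visit contributes `2⁻⁴`, so a product below `2⁻ⁿ` forces more than `n / 4` visits.
  have hlt : n < 4 * c.card := by
    by_contra! hle
    refine hω ?_
    change 2⁻¹ ^ n ≤ ∏ τ ∈ Finset.Ico 1 (n + 1), visitWeight G (R.env τ ω)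
    rw [hprod]
    exact pow_le_pow_of_le_one (by simp) (by simp) hle
  have hlt' : (n : ℝ) ≤ 4 * c.card := by exact_mod_cast hlt.le
  calc η ^ 2 * (n / 4) ≤ η ^ 2 * c.card := by gcongr; linarith
    _ = ∑ τ ∈ c, η ^ 2 := by rw [Finset.sum_const, nsmul_eq_mul, mul_comm]
    _ ≤ ∑ τ ∈ c, inner ℝ u (R.chosenXhat M τ ω) ^ 2 := Finset.sum_le_sum fun τ hτ => by
      rw [← sq_abs (inner ℝ u _), chosenXhat_eq_estimate]
      gcongr
      exact hG _ (Finset.mem_filter.1 hτ).2 _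
    _ ≤ _ := Finset.sum_le_sum_of_subset_of_nonneg (Finset.filter_subset _ _)
      fun _ _ _ => sq_nonneg _

end BanditRun

/-! ### Auxiliary bounds -/

/-- A Gaussian law with an atom is a Dirac mass, which has zero variance in every direction. -/
theorem multivariateGaussian_singleton {d : ℕ} [NeZero d] (μ x : EuclideanSpace ℝ (Fin d))
    {S : Matrix (Fin d) (Fin d) ℝ} (hS : S.PosDef) : multivariateGaussian μ S {x} = 0 := by
  have h : NullSingletonClass (multivariateGaussian μ S) := by
    refine IsGaussian.nullSingletonClass fun y hy => ?_
    set u : EuclideanSpace ℝ (Fin d) := EuclideanSpace.single 0 1 with hu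
    have h1 := BanditModel.covariance_inner_multivariateGaussian hS.posSemidef μ u u
    rw [hy, covariance_self (by fun_prop), variance_dirac, ← dotProduct_ofLp_eq_inner] at h1
    refine (hS.dotProduct_mulVec_pos (x := u.ofLp) ?_).ne h1
    intro h0
    have := congrFun h0 0
    simp [hu] at this
  exact measure_singleton x

theorem enorm_sum_pow_le {ι E : Type*} [SeminormedAddCommGroup E] (s : Finset ι) (f : ι → E) (q : ℕ) :
    ‖∑ i ∈ s, f i‖ₑ ^ (q + 1) ≤ (s.card : ENNReal) ^ q * ∑ i ∈ s, ‖f i‖ₑ ^ (q + 1) := by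
  have h1 : ‖∑ i ∈ s, f i‖₊ ^ (q + 1) ≤ (s.card : ℝ≥0) ^ q * ∑ i ∈ s, ‖f i‖₊ ^ (q + 1) :=
    (pow_le_pow_left' (nnnorm_sum_le _ _) _).trans
      (pow_sum_le_card_mul_sum_pow (fun _ _ => bot_le) q)
  simp only [enorm_eq_nnnorm]
  exact_mod_cast h1

theorem exists_pow_mul_geometric_le (r : ℝ) (hr0 : 0 ≤ r) (hr : r < 1) (k : ℕ) :
    ∃ C, ∀ n : ℕ, r ^ n ≤ C * (((n : ℝ) + 1) ^ k)⁻¹ := by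
  rcases hr0.eq_or_lt with rfl | hr0
  · refine ⟨1, fun n => ?_⟩
    rcases n with _ | n
    · simp
    · rw [zero_pow (by omega)]
      positivity
  have h := ((tendsto_pow_const_mul_const_pow_of_abs_lt_one k (abs_lt.2 ⟨by linarith, hr⟩)).comp
    (tendsto_add_atTop_nat 1)).bddAbove_range
  obtain ⟨C, hC⟩ := h
  refine ⟨C / r, fun n => ?_⟩
  have h1 := hC ⟨n, rfl⟩
  simp only [Function.comp, Nat.cast_add, Nat.cast_one] at h1
  rw [← div_eq_mul_inv, le_div_iff₀ (by positivity), le_div_iff₀ hr0]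
  calc _ = ((n : ℝ) + 1) ^ k * r ^ (n + 1) := by ring
    _ ≤ C := h1

/-! ### Linear growth of the precision matrix -/

namespace BanditRun

variable {Ω : Type*} [MeasurableSpace Ω] {P : Measure Ω} {d N : ℕ}
  {R : BanditRun Ω d N} {M : BanditModel d}

theorem IsThompsonSampling.history_le (hR : R.IsThompsonSampling M P) (t : ℕ) :
    R.history t ≤ ‹MeasurableSpace Ω› :=
  iSup₂_le fun τ hτ => by
    have h1 := (Finset.mem_Ico.1 hτ).1
    exact sup_le (sup_le (hR.measurable_env τ h1).comap_le (hR.measurable_sample τ h1).comap_le)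
      (hR.measurable_arm τ h1).comap_le

theorem IsThompsonSampling.measurePreserving_env (hR : R.IsThompsonSampling M P) {t : ℕ}
    (ht : 1 ≤ t) : MeasurePreserving (R.env t) P (M.jointLaw N) :=
  ⟨hR.measurable_env t ht, hR.env_law t ht⟩

theorem IsThompsonSampling.measurable_score (hR : R.IsThompsonSampling M P) {t : ℕ} (ht : 1 ≤ t) :
    Measurable (R.score M t) :=
  BanditRun.measurable_score (hR.measurable_env t ht) (hR.measurable_arm t ht)

theorem IsThompsonSampling.measurable_posterior (hR : R.IsThompsonSampling M P) (t : ℕ) :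
    Measurable (R.posterior M t) :=
  (measurable_posterior_history t).mono (hR.history_le t) le_rfl

section Design

theorem measurable_visitWeight
    {G : Set (Fin N → EuclideanSpace ℝ (Fin d) × EuclideanSpace ℝ (Fin d) × ℝ)}
    (hG : MeasurableSet G) : Measurable (visitWeight G) :=
  Measurable.ite hG measurable_const measurable_const

/-- The complement contributes at most `1/4` and the visits at most `1/16`. What matters is that the
total is below `1/2`, the rate of the threshold in `rarelyVisits`. -/
theorem lintegral_visitWeight_le
    {G : Set (Fin N → EuclideanSpace ℝ (Fin d) × EuclideanSpace ℝ (Fin d) × ℝ)}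
    (hG : MeasurableSet G) (h : 3 / 4 ≤ M.jointLaw N G) :
    ∫⁻ e, visitWeight G e ∂(M.jointLaw N) ≤ ENNReal.ofReal (5 / 16) := by
  have h1 : ∀ e, visitWeight G e ≤ Gᶜ.indicator 1 e + 2⁻¹ ^ 4 := fun e => by
    by_cases he : e ∈ G <;> simp [visitWeight, he]
  have hc : M.jointLaw N Gᶜ ≤ ENNReal.ofReal (1 / 4) := by
    rw [prob_compl_eq_one_sub hG]
    refine (tsub_le_tsub_left h 1).trans (tsub_le_iff_right.2 ?_)
    have : (3 / 4 : ENNReal) = ENNReal.ofReal (3 / 4) := by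
      rw [ENNReal.ofReal_div_of_pos (by norm_num)]
      norm_num
    rw [this, ← ENNReal.ofReal_add (by norm_num) (by norm_num)]
    norm_num
  have h16 : (2⁻¹ : ENNReal) ^ 4 = ENNReal.ofReal (1 / 16) := by
    rw [← ENNReal.ofReal_ofNat 2, ← ENNReal.ofReal_inv_of_pos (by norm_num),
      ← ENNReal.ofReal_pow (by norm_num)]
    norm_num
  calc _ ≤ ∫⁻ e, (Gᶜ.indicator 1 e + 2⁻¹ ^ 4) ∂(M.jointLaw N) := lintegral_mono h1
    _ = M.jointLaw N Gᶜ + 2⁻¹ ^ 4 := by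
      rw [lintegral_add_right _ measurable_const, lintegral_indicator_one hG.compl]
      simp
    _ ≤ ENNReal.ofReal (1 / 4) + ENNReal.ofReal (1 / 16) := by
      rw [h16]
      gcongr
    _ = _ := by
      rw [← ENNReal.ofReal_add (by norm_num) (by norm_num)]
      norm_num

theorem IsThompsonSampling.lintegral_prod_visitWeight_le [IsProbabilityMeasure P]
    (hR : R.IsThompsonSampling M P)
    {G : Set (Fin N → EuclideanSpace ℝ (Fin d) × EuclideanSpace ℝ (Fin d) × ℝ)}
    (hG : MeasurableSet G) (h : 3 / 4 ≤ M.jointLaw N G) (n : ℕ) :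
    ∫⁻ ω, ∏ τ ∈ Finset.Ico 1 (n + 1), visitWeight G (R.env τ ω) ∂P
      ≤ ENNReal.ofReal (5 / 16) ^ n := by
  induction n with
  | zero => simp
  | succ n ih =>
    simp_rw [Finset.prod_Ico_succ_top (Nat.succ_le_succ (Nat.zero_le n))]
    have hf : Measurable[R.history (n + 1)]
        (fun ω => ∏ τ ∈ Finset.Ico 1 (n + 1), visitWeight G (R.env τ ω)) :=
      Finset.measurable_fun_prod _ fun τ hτ =>
        (measurable_visitWeight hG).comp (measurable_env_history hτ)
    have hg : Measurable[MeasurableSpace.comap (R.env (n + 1)) inferInstance]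
        (fun ω => visitWeight G (R.env (n + 1) ω)) :=
      (measurable_visitWeight hG).comp (comap_measurable _)
    rw [lintegral_mul_eq_lintegral_mul_lintegral_of_independent_measurableSpace (hR.history_le _)
      (hR.measurable_env _ (by omega)).comap_le (hR.env_indep _ (by omega)) hf hg, pow_succ]
    gcongr
    rw [(hR.measurePreserving_env (t := n + 1) (by omega)).lintegral_comp (measurable_visitWeight hG)]
    exact lintegral_visitWeight_le hG h

theorem IsThompsonSampling.measurable_prod_visitWeight (hR : R.IsThompsonSampling M P)
    {G : Set (Fin N → EuclideanSpace ℝ (Fin d) × EuclideanSpace ℝ (Fin d) × ℝ)}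
    (hG : MeasurableSet G) (n : ℕ) :
    Measurable fun ω => ∏ τ ∈ Finset.Ico 1 (n + 1), visitWeight G (R.env τ ω) :=
  Finset.measurable_fun_prod _ fun τ hτ =>
    (measurable_visitWeight hG).comp (hR.measurable_env τ (Finset.mem_Ico.1 hτ).1)

theorem IsThompsonSampling.measurableSet_rarelyVisits (hR : R.IsThompsonSampling M P)
    {G : Set (Fin N → EuclideanSpace ℝ (Fin d) × EuclideanSpace ℝ (Fin d) × ℝ)}
    (hG : MeasurableSet G) (n : ℕ) : MeasurableSet (R.rarelyVisits G n) :=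
  measurableSet_le measurable_const (hR.measurable_prod_visitWeight hG n)

/-- Markov's inequality at level `2⁻ⁿ` gives `(2 · 5/16)ⁿ`. -/
theorem IsThompsonSampling.measure_rarelyVisits_le [IsProbabilityMeasure P]
    (hR : R.IsThompsonSampling M P)
    {G : Set (Fin N → EuclideanSpace ℝ (Fin d) × EuclideanSpace ℝ (Fin d) × ℝ)}
    (hG : MeasurableSet G) (h : 3 / 4 ≤ M.jointLaw N G) (n : ℕ) :
    P (R.rarelyVisits G n) ≤ ENNReal.ofReal ((5 / 8) ^ n) := by
  have hm := mul_meas_ge_le_lintegral (μ := P) (hR.measurable_prod_visitWeight hG n) (2⁻¹ ^ n)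
  have h1 := hm.trans (hR.lintegral_prod_visitWeight_le hG h n)
  have h2 : P (R.rarelyVisits G n) = 2 ^ n * (2⁻¹ ^ n * P (R.rarelyVisits G n)) := by
    rw [← mul_assoc, ← mul_pow, ENNReal.mul_inv_cancel (by norm_num) (by norm_num), one_pow, one_mul]
  rw [h2]
  calc _ ≤ 2 ^ n * ENNReal.ofReal (5 / 16) ^ n := by gcongr; exact h1
    _ = _ := by
      rw [← mul_pow, ← ENNReal.ofReal_ofNat 2, ← ENNReal.ofReal_mul (by norm_num),
        ← ENNReal.ofReal_pow (by norm_num)]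
      norm_num

/-- The precision matrix grows linearly outside of events of small probability. -/
theorem IsThompsonSampling.exists_norm_B_inv_le [IsProbabilityMeasure P]
    (hR : R.IsThompsonSampling M P) (k : ℕ) :
    ∃ (bad : ℕ → Set Ω) (b C : ℝ), 0 < b ∧ 0 ≤ C ∧ (∀ n, MeasurableSet (bad n)) ∧
      (∀ n, P (bad n) ≤ ENNReal.ofReal (C * (((n : ℝ) + 1) ^ k)⁻¹)) ∧
      (∀ t ω, ‖(R.B M t ω)⁻¹‖ ≤ b⁻¹) ∧
      ∀ n, ∀ ω ∉ bad n, ‖(R.B M (n + 1) ω)⁻¹‖ ≤ (b * ((n : ℝ) + 1))⁻¹ := by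
  obtain ⟨s, G, η, hη, hGm, hGP, hcov⟩ := BanditModel.exists_finite_wellSpread_cover M N
  obtain ⟨b₀, hb₀, hprior⟩ := M.prior_posDef.inv.exists_coercive
  obtain ⟨C, hC⟩ := exists_pow_mul_geometric_le (5 / 8) (by norm_num) (by norm_num) k
  -- The prior contributes `b₀` and `n` steps contribute `(η²/4) n`, so the minimum times `n + 1` is
  -- a lower bound for the quadratic form on the unit sphere.
  have hb : 0 < min b₀ (η ^ 2 / 4) := lt_min hb₀ (by positivity)
  refine ⟨fun n => ⋃ j ∈ s, R.rarelyVisits (G j) n, min b₀ (η ^ 2 / 4), s.card * C, hb,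
    mul_nonneg (Nat.cast_nonneg _) (zero_le_one.trans (by simpa using hC 0)), fun n => Finset.measurableSet_biUnion s fun k hk =>
      hR.measurableSet_rarelyVisits (hGm k hk) n, fun n => ?_, fun t ω => ?_, fun n ω hω => ?_⟩
  · refine (measure_biUnion_finset_le s _).trans ?_
    calc _ ≤ ∑ _j ∈ s, ENNReal.ofReal (C * (((n : ℝ) + 1) ^ k)⁻¹) := by
          refine Finset.sum_le_sum fun j hj => (hR.measure_rarelyVisits_le (hGm j hj) (hGP j hj) n).trans ?_
          exact ENNReal.ofReal_le_ofReal (hC n)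
      _ = _ := by
          rw [Finset.sum_const, nsmul_eq_mul, mul_assoc, ENNReal.ofReal_mul (Nat.cast_nonneg _),
            ENNReal.ofReal_natCast]
  · refine norm_inv_le_of_coercive (posDef_B t ω) hb fun u => ?_
    rw [dotProduct_B_mulVec]
    have h1 := hprior u
    have h2 : 0 ≤ ∑ τ ∈ Finset.Ico 1 t, inner ℝ u (R.chosenXhat M τ ω) ^ 2 :=
      Finset.sum_nonneg fun _ _ => sq_nonneg _
    have h3 : min b₀ (η ^ 2 / 4) * ‖u‖ ^ 2 ≤ b₀ * ‖u‖ ^ 2 := by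
      gcongr
      exact min_le_left _ _
    linarith
  · refine norm_inv_le_of_coercive (posDef_B _ ω) (by positivity) fun u => ?_
    rw [dotProduct_B_mulVec]
    rcases eq_or_ne u 0 with rfl | hu
    · simp
    have hn : ‖u‖ ≠ 0 := norm_ne_zero_iff.2 hu
    obtain ⟨k, hk, hkG⟩ := hcov (‖u‖⁻¹ • u)
      (by rw [norm_smul, norm_inv, norm_norm, inv_mul_cancel₀ hn])
    have hωk : ω ∉ R.rarelyVisits (G k) n := fun h => hω (Set.mem_biUnion hk h)
    have h1 := le_sum_sq_of_notMem_rarelyVisits hωk hη hkG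
    simp only [real_inner_smul_left, mul_pow] at h1
    rw [← Finset.mul_sum] at h1
    have h2 : η ^ 2 * (n / 4) * ‖u‖ ^ 2
        ≤ ∑ τ ∈ Finset.Ico 1 (n + 1), inner ℝ u (R.chosenXhat M τ ω) ^ 2 := by
      calc _ ≤ _ := mul_le_mul_of_nonneg_right h1 (sq_nonneg ‖u‖)
        _ = _ := by field_simp
    calc min b₀ (η ^ 2 / 4) * ((n : ℝ) + 1) * ‖u‖ ^ 2
        = min b₀ (η ^ 2 / 4) * ‖u‖ ^ 2 + min b₀ (η ^ 2 / 4) * n * ‖u‖ ^ 2 := by ring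
      _ ≤ b₀ * ‖u‖ ^ 2 + (η ^ 2 / 4) * n * ‖u‖ ^ 2 := by
        gcongr
        · exact min_le_left _ _
        · exact min_le_right _ _
      _ ≤ _ := by
        refine add_le_add (hprior u) (le_trans (le_of_eq ?_) h2)
        ring

end Design

end BanditRun

/-! ### The posterior sample and the uniqueness of the maximizing arm -/

namespace BanditRun

variable {Ω : Type*} {d N : ℕ}

/-- Pairs (sample, estimated contexts) for which arm `i` is the unique maximizer. -/
def leadSet (d : ℕ) {N : ℕ} (i : Fin N) :
    Set (EuclideanSpace ℝ (Fin d) × (Fin N → EuclideanSpace ℝ (Fin d))) :=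
  {p | ∀ j, j ≠ i → (inner ℝ (p.2 j) p.1 : ℝ) < inner ℝ (p.2 i) p.1}

theorem measurableSet_leadSet (i : Fin N) : MeasurableSet (leadSet d i) := by
  have : leadSet d i = ⋂ j, ⋂ (_ : j ≠ i), {p | (inner ℝ (p.2 j) p.1 : ℝ) < inner ℝ (p.2 i) p.1} := by
    ext p; simp [leadSet]
  rw [this]
  exact MeasurableSet.iInter fun j => MeasurableSet.iInter fun _ =>
    measurableSet_lt (by fun_prop) (by fun_prop)

/-- Indicator that arm `i` is the unique maximizer at time `t`. -/
noncomputable def leads (R : BanditRun Ω d N) (M : BanditModel d) (t : ℕ) (i : Fin N) (ω : Ω) : ℝ :=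
  (leadSet d i).indicator 1 (R.sample t ω, fun j => M.estimate (R.env t ω j))

variable [MeasurableSpace Ω] {P : Measure Ω}
  {R : BanditRun Ω d N} {M : BanditModel d}

theorem IsThompsonSampling.history_sup_env_le (hR : R.IsThompsonSampling M P) {t : ℕ} (ht : 1 ≤ t) :
    R.history t ⊔ MeasurableSpace.comap (R.env t) inferInstance ≤ ‹MeasurableSpace Ω› :=
  sup_le (hR.history_le t) (hR.measurable_env t ht).comap_le

theorem IsThompsonSampling.condLaw_sample (hR : R.IsThompsonSampling M P) {t : ℕ} (ht : 1 ≤ t)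
    (s : Set (EuclideanSpace ℝ (Fin d))) (hs : MeasurableSet s) :
    P⟦R.sample t ⁻¹' s | R.history t ⊔ MeasurableSpace.comap (R.env t) inferInstance⟧
      =ᵐ[P] fun ω => (gaussianKernel d (R.posterior M t ω)).real s :=
  hR.sample_law t ht s hs

variable [IsProbabilityMeasure P]

theorem IsThompsonSampling.indepFun_prodMk_sample_env (hR : R.IsThompsonSampling M P) {t : ℕ}
    (ht : 1 ≤ t) {U : Type*} [MeasurableSpace U] {u : Ω → U} (hu : Measurable[R.history t] u) :
    IndepFun (fun ω => (u ω, R.sample t ω)) (R.env t) P :=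
  indepFun_prodMk_of_condLaw (hR.history_le t) (hR.measurable_env t ht) (hR.measurable_sample t ht)
    (hR.env_indep t ht) (hR.condLaw_sample ht) (measurable_posterior_history t) hu

theorem IsThompsonSampling.lintegral_enorm_sample_sub_muHat_le (hR : R.IsThompsonSampling M P)
    {t : ℕ} (ht : 1 ≤ t) (q : ℕ) :
    ∫⁻ ω, ‖R.sample t ω - R.muHat M t ω‖ₑ ^ (2 * q) ∂P
      ≤ (∫⁻ ω, ‖(R.B M t ω)⁻¹‖ₑ ^ q ∂P) * stdGaussianMoment d q := by
  have hθ : Measurable (R.posterior M t) := hR.measurable_posterior t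
  have hlaw := map_prodMk_eq_compProd_of_condLaw (hR.history_sup_env_le ht)
    (hR.measurable_sample t ht) (hR.condLaw_sample ht)
    ((measurable_posterior_history t).mono le_sup_left le_rfl)
  have hf : Measurable fun p : (EuclideanSpace ℝ (Fin d) × (Fin d → Fin d → ℝ)) ×
      EuclideanSpace ℝ (Fin d) => ‖p.2 - p.1.1‖ₑ ^ (2 * q) := by fun_prop
  have h1 := lintegral_map (μ := P) hf (hθ.prodMk (hR.measurable_sample t ht))
  rw [hlaw, Measure.lintegral_compProd hf, lintegral_map hf.lintegral_kernel_prod_right' hθ] at h1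
  refine (h1.symm.le.trans (lintegral_mono fun ω => ?_)).trans
    (lintegral_mul_const' _ _ (stdGaussianMoment_ne_top d q)).le
  exact lintegral_enorm_sub_pow_multivariateGaussian_le _ (posDef_B t ω).inv.posSemidef q

theorem IsThompsonSampling.ae_sample_ne_zero [NeZero d] (hR : R.IsThompsonSampling M P) {t : ℕ}
    (ht : 1 ≤ t) : ∀ᵐ ω ∂P, R.sample t ω ≠ 0 := by
  have h := measure_inter_preimage_of_condLaw (hR.history_sup_env_le ht)
    (hR.measurable_sample t ht) (hR.condLaw_sample ht) MeasurableSet.univ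
    (measurableSet_singleton (0 : EuclideanSpace ℝ (Fin d)))
  have h0 : ∀ ω, gaussianKernel d (R.posterior M t ω) {0} = 0 := fun ω =>
    multivariateGaussian_singleton _ _ (posDef_B t ω).inv
  simp only [h0, lintegral_zero, Set.univ_inter] at h
  exact measure_eq_zero_iff_ae_notMem.1 h

/-- The sample is independent of the current environment and almost surely nonzero, so by Fubini it
may be frozen at a nonzero vector, where ties are null. -/
theorem IsThompsonSampling.ae_inner_xhat_ne [NeZero d] (hR : R.IsThompsonSampling M P) {t : ℕ}
    (ht : 1 ≤ t) {i j : Fin N} (hij : i ≠ j) :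
    ∀ᵐ ω ∂P, (inner ℝ (R.sample t ω) (R.xhat M t i ω) : ℝ)
      ≠ inner ℝ (R.sample t ω) (R.xhat M t j ω) := by
  have hs := hR.measurable_sample t ht
  have he := hR.measurable_env t ht
  have hind : IndepFun (R.sample t) (R.env t) P :=
    (hR.indepFun_prodMk_sample_env ht (u := fun _ => ()) measurable_const).comp measurable_snd
      measurable_id
  have hlaw := (indepFun_iff_map_prod_eq_prod_map_map hs.aemeasurable he.aemeasurable).1 hind
  have hme : ∀ i : Fin N, Measurable fun p : EuclideanSpace ℝ (Fin d) ×
      (Fin N → EuclideanSpace ℝ (Fin d) × EuclideanSpace ℝ (Fin d) × ℝ) =>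
        (inner ℝ p.1 (M.estimate (p.2 i)) : ℝ) := fun i => by
    have h1 : Measurable fun p : EuclideanSpace ℝ (Fin d) ×
      (Fin N → EuclideanSpace ℝ (Fin d) × EuclideanSpace ℝ (Fin d) × ℝ) => M.estimate (p.2 i) :=
      M.estimate.continuous.measurable.comp ((measurable_pi_apply i).comp measurable_snd)
    exact measurable_fst.inner h1
  have hD := measurableSet_eq_fun (hme i) (hme j)
  suffices h : P ((fun ω => (R.sample t ω, R.env t ω)) ⁻¹'
      {p | (inner ℝ p.1 (M.estimate (p.2 i)) : ℝ) = inner ℝ p.1 (M.estimate (p.2 j))}) = 0 from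
    measure_eq_zero_iff_ae_notMem.1 h
  have hPs : IsProbabilityMeasure (P.map (R.sample t)) := Measure.isProbabilityMeasure_map hs.aemeasurable
  rw [← Measure.map_apply (hs.prodMk he) hD, hlaw, (hR.measurePreserving_env ht).map_eq,
    Measure.measure_prod_null hD]
  have hne : ∀ᵐ m ∂(P.map (R.sample t)), m ≠ 0 :=
    (ae_map_iff hs.aemeasurable (measurableSet_singleton _).compl).2 (hR.ae_sample_ne_zero ht)
  filter_upwards [hne] with m hm
  exact BanditModel.jointLaw_inner_estimate_eq hm hij

/-- The tie-breaking rule is unspecified and might look at the residuals. Almost surely there is no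
tie, so the chosen arm can be replaced by a function of the sample and the estimates. -/
theorem IsThompsonSampling.ae_leads_eq [NeZero d] (hR : R.IsThompsonSampling M P) {t : ℕ}
    (ht : 1 ≤ t) : ∀ᵐ ω ∂P, ∀ i, R.leads M t i ω = if R.arm t ω = i then 1 else 0 := by
  have h : ∀ i j : Fin N, ∀ᵐ ω ∂P, i ≠ j → (inner ℝ (R.sample t ω) (R.xhat M t i ω) : ℝ)
      ≠ inner ℝ (R.sample t ω) (R.xhat M t j ω) := fun i j => by
    by_cases hij : i = j
    · exact ae_of_all _ fun ω h => absurd hij h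
    · filter_upwards [hR.ae_inner_xhat_ne ht hij] with ω hω _ using hω
  filter_upwards [ae_all_iff.2 fun i => ae_all_iff.2 (h i)] with ω hω i
  have hmax := hR.arm_max t ht ω
  simp only [leads, chosenXhat_eq_estimate, xhat_eq_estimate] at hmax hω ⊢
  split_ifs with hi
  · rw [Set.indicator_of_mem, Pi.one_apply]
    intro j hj
    refine lt_of_le_of_ne (hi ▸ hmax j) ?_
    have := hω j i hj
    rwa [real_inner_comm, real_inner_comm (M.estimate (R.env t ω i))] at this
  · rw [Set.indicator_of_notMem]
    intro hmem
    exact absurd (hmem (R.arm t ω) hi) (not_lt.2 (hmax i))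

end BanditRun

/-! ### Moments and orthogonality of the scores -/

namespace BanditModel

variable {d : ℕ}

/-- A bound on the moment of order `p` of the norms of the scores. -/
noncomputable def scoreMoment (M : BanditModel d) (N p : ℕ) : ENNReal :=
  N * ∫⁻ e, ‖M.residual e • M.estimate e‖ₑ ^ p ∂M.envLaw

theorem scoreMoment_ne_top (M : BanditModel d) (N p : ℕ) : M.scoreMoment N p ≠ ⊤ := by
  refine ENNReal.mul_ne_top (ENNReal.natCast_ne_top N) (ne_top_of_le_ne_top (b :=
    ((‖M.residual‖ₑ * ‖M.estimate‖ₑ) ^ p * ∫⁻ e, ‖e‖ₑ ^ (2 * p) ∂M.envLaw)) ?_ ?_)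
  · exact ENNReal.mul_ne_top (ENNReal.pow_ne_top (ENNReal.mul_ne_top enorm_ne_top enorm_ne_top))
      (IsGaussian.lintegral_enorm_pow_ne_top M.envLaw (2 * p))
  · rw [← lintegral_const_mul _ (by fun_prop)]
    refine lintegral_mono fun e => ?_
    rw [pow_mul, ← mul_pow]
    gcongr
    rw [enorm_smul, sq, mul_mul_mul_comm]
    gcongr
    · exact M.residual.le_opENorm e
    · exact M.estimate.le_opENorm e

end BanditModel

theorem memLp_natCast_of_lintegral_enorm_pow_ne_top {Ω E : Type*} [MeasurableSpace Ω]
    {P : Measure Ω} [NormedAddCommGroup E] {f : Ω → E} (hf : AEStronglyMeasurable f P) {p : ℕ}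
    (hp : p ≠ 0) (h : ∫⁻ ω, ‖f ω‖ₑ ^ p ∂P ≠ ⊤) : MemLp f p P := by
  refine ⟨hf, ?_⟩
  rw [eLpNorm_lt_top_iff_lintegral_rpow_enorm_lt_top (by exact_mod_cast hp) (by simp)]
  simpa using h.lt_top

theorem integral_norm_pow_eq_toReal_lintegral {Ω E : Type*} [MeasurableSpace Ω] {P : Measure Ω}
    [NormedAddCommGroup E] {f : Ω → E} (hf : AEStronglyMeasurable f P) (p : ℕ) :
    ∫ ω, ‖f ω‖ ^ p ∂P = (∫⁻ ω, ‖f ω‖ₑ ^ p ∂P).toReal := by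
  have hm : AEStronglyMeasurable (fun ω => ‖f ω‖ ^ p) P := hf.norm.pow p
  rw [integral_eq_lintegral_of_nonneg_ae (ae_of_all _ fun ω => by positivity) hm]
  congr 1
  refine lintegral_congr fun ω => ?_
  rw [ENNReal.ofReal_pow (norm_nonneg _), ofReal_norm]

namespace BanditRun

attribute [local irreducible] BanditModel.estimate BanditModel.residual

variable {Ω : Type*} {d N : ℕ} {R : BanditRun Ω d N} {M : BanditModel d}

theorem sum_Ico_score (n : ℕ) (ω : Ω) :
    ∑ τ ∈ Finset.Ico 1 (n + 1), R.score M τ ω = ∑ i ∈ Finset.range n, R.score M (i + 1) ω := by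
  rw [Finset.sum_Ico_eq_sum_range]
  simp [add_comm]

variable [MeasurableSpace Ω] {P : Measure Ω}

/-- The chosen arm is random, so its term is bounded by the sum over all arms, each of which has a
known law. -/
theorem IsThompsonSampling.lintegral_enorm_score_pow_le (hR : R.IsThompsonSampling M P) {t : ℕ}
    (ht : 1 ≤ t) (p : ℕ) : ∫⁻ ω, ‖R.score M t ω‖ₑ ^ p ∂P ≤ M.scoreMoment N p := by
  have hm : Measurable fun e : EuclideanSpace ℝ (Fin d) × EuclideanSpace ℝ (Fin d) × ℝ =>
      ‖M.residual e • M.estimate e‖ₑ ^ p := by fun_prop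
  calc ∫⁻ ω, ‖R.score M t ω‖ₑ ^ p ∂P
      ≤ ∫⁻ ω, ∑ i, ‖M.residual (R.env t ω i) • M.estimate (R.env t ω i)‖ₑ ^ p ∂P := by
        refine lintegral_mono fun ω => ?_
        simp only [score, chosenXhat_eq_estimate]
        exact Finset.single_le_sum (f := fun i =>
          ‖M.residual (R.env t ω i) • M.estimate (R.env t ω i)‖ₑ ^ p) (fun _ _ => bot_le)
          (Finset.mem_univ (R.arm t ω))
    _ = ∑ _i : Fin N, ∫⁻ e, ‖M.residual e • M.estimate e‖ₑ ^ p ∂M.envLaw := by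
        have hmi : ∀ i : Fin N, Measurable fun ω =>
            ‖M.residual (R.env t ω i) • M.estimate (R.env t ω i)‖ₑ ^ p := fun i =>
          hm.comp ((measurable_pi_apply i).comp (hR.measurable_env t ht))
        rw [lintegral_finsetSum _ fun i _ => hmi i]
        refine Finset.sum_congr rfl fun i _ => ?_
        have hmp := (BanditModel.measurePreserving_eval_jointLaw (M := M) i).comp
          (hR.measurePreserving_env ht)
        exact hmp.lintegral_comp hm
    _ = _ := by simp [BanditModel.scoreMoment]

theorem IsThompsonSampling.memLp_score (hR : R.IsThompsonSampling M P) {t : ℕ} (ht : 1 ≤ t)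
    {p : ℕ} (hp : p ≠ 0) : MemLp (R.score M t) p P :=
  memLp_natCast_of_lintegral_enorm_pow_ne_top (hR.measurable_score ht).aestronglyMeasurable hp
    (ne_top_of_le_ne_top (M.scoreMoment_ne_top N p) (hR.lintegral_enorm_score_pow_le ht p))

theorem IsThompsonSampling.memLp_residual_smul_xhat (hR : R.IsThompsonSampling M P) {t : ℕ}
    (ht : 1 ≤ t) (i : Fin N) :
    MemLp (fun ω => M.residual (R.env t ω i) • M.estimate (R.env t ω i)) 2 P := by
  have hmp := (BanditModel.measurePreserving_eval_jointLaw (M := M) i).comp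
    (hR.measurePreserving_env ht)
  have hN : NeZero N := ⟨fun h => by subst h; exact i.elim0⟩
  have h : MemLp (fun e => M.residual e • M.estimate e) (2 : ℕ) M.envLaw := by
    refine memLp_natCast_of_lintegral_enorm_pow_ne_top
      (by fun_prop : Measurable _).aestronglyMeasurable two_ne_zero fun htop => ?_
    refine M.scoreMoment_ne_top N 2 ?_
    rw [BanditModel.scoreMoment, htop, ENNReal.mul_top]
    exact_mod_cast hN.out
  exact h.comp_measurePreserving hmp

theorem IsThompsonSampling.integral_norm_score_sq_le (hR : R.IsThompsonSampling M P) (n : ℕ) :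
    ∫ ω, ‖R.score M (n + 1) ω‖ ^ 2 ∂P ≤ (M.scoreMoment N 2).toReal := by
  rw [integral_norm_pow_eq_toReal_lintegral
    (hR.measurable_score (by omega)).aestronglyMeasurable]
  exact ENNReal.toReal_mono (M.scoreMoment_ne_top N 2) (hR.lintegral_enorm_score_pow_le (by omega) 2)

theorem IsThompsonSampling.memLp_sum_score (hR : R.IsThompsonSampling M P) (n : ℕ) {p : ℕ}
    (hp : p ≠ 0) : MemLp (fun ω => ∑ τ ∈ Finset.Ico 1 (n + 1), R.score M τ ω) p P :=
  memLp_finsetSum _ fun _ hτ => hR.memLp_score (Finset.mem_Ico.1 hτ).1 hp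

/-- A crude bound by the power mean inequality, without orthogonality. It is used only to control
the sum on the improbable event where `B` is small. -/
theorem IsThompsonSampling.integral_norm_sum_score_pow_four_le (hR : R.IsThompsonSampling M P)
    (n : ℕ) :
    ∫ ω, ‖∑ τ ∈ Finset.Ico 1 (n + 1), R.score M τ ω‖ ^ 4 ∂P
      ≤ (M.scoreMoment N 4).toReal * (n : ℝ) ^ 4 := by
  rw [integral_norm_pow_eq_toReal_lintegral (hR.memLp_sum_score n (p := 4) (by norm_num)).1]
  have h : ∫⁻ ω, ‖∑ τ ∈ Finset.Ico 1 (n + 1), R.score M τ ω‖ₑ ^ 4 ∂P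
      ≤ M.scoreMoment N 4 * (n : ENNReal) ^ 4 := by
    calc _ ≤ ∫⁻ ω, (n : ENNReal) ^ 3 * ∑ τ ∈ Finset.Ico 1 (n + 1), ‖R.score M τ ω‖ₑ ^ 4 ∂P := by
          refine lintegral_mono fun ω => ?_
          simpa using enorm_sum_pow_le (Finset.Ico 1 (n + 1)) (fun τ => R.score M τ ω) 3
      _ = (n : ENNReal) ^ 3 * ∑ τ ∈ Finset.Ico 1 (n + 1), ∫⁻ ω, ‖R.score M τ ω‖ₑ ^ 4 ∂P := by
          rw [lintegral_const_mul' _ _ (by simp), lintegral_finsetSum' _ fun τ hτ =>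
            (hR.measurable_score (Finset.mem_Ico.1 hτ).1).enorm.aemeasurable.pow_const 4]
      _ ≤ (n : ENNReal) ^ 3 * ∑ _τ ∈ Finset.Ico 1 (n + 1), M.scoreMoment N 4 := by
          gcongr with τ hτ
          exact hR.lintegral_enorm_score_pow_le (Finset.mem_Ico.1 hτ).1 4
      _ = _ := by
          rw [Finset.sum_const, Nat.card_Ico, nsmul_eq_mul, Nat.add_sub_cancel]
          ring
  refine (ENNReal.toReal_mono (ENNReal.mul_ne_top (M.scoreMoment_ne_top N 4) (by simp)) h).trans ?_
  rw [ENNReal.toReal_mul]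
  simp

variable [IsProbabilityMeasure P]

/-- The martingale difference property: the residual of each arm is centred and independent of the
past, the sample and all current estimates. -/
theorem IsThompsonSampling.integral_inner_score (hR : R.IsThompsonSampling M P) {s t : ℕ}
    (hs : 1 ≤ s) (hst : s < t) : ∫ ω, inner ℝ (R.score M s ω) (R.score M t ω) ∂P = 0 := by
  -- In dimension zero all arms tie, but the scores vanish.
  rcases Nat.eq_zero_or_pos d with rfl | hd
  · have : ∀ ω, R.score M s ω = 0 := fun ω => Subsingleton.elim _ _
    simp [this]
  have : NeZero d := ⟨hd.ne'⟩
  have ht : 1 ≤ t := hs.trans hst.le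
  have henv := hR.measurable_env t ht
  have hsm : Measurable (R.sample t) := hR.measurable_sample t ht
  have hsc : Measurable[R.history t] (R.score M s) :=
    measurable_score_history (Finset.mem_Ico.2 ⟨hs, hst⟩)
  have hsc0 : Measurable (R.score M s) := hR.measurable_score hs
  have hxh : Measurable fun ω j => M.estimate (R.env t ω j) :=
    BanditModel.measurable_estimate_pi.comp henv
  have hres : ∀ i, Measurable fun ω => M.residual (R.env t ω i) := fun i =>
    M.residual.continuous.measurable.comp ((measurable_pi_apply i).comp henv)
  -- `Y i` collects every factor other than the residual of arm `i`, with `leads` replacing the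
  -- event that arm `i` is chosen.
  set Y : Fin N → Ω → ℝ := fun i ω => inner ℝ (R.score M s ω) (M.estimate (R.env t ω i)) * R.leads M t i ω
    with hY
  have hfun : ∀ i : Fin N, Measurable fun q : (EuclideanSpace ℝ (Fin d) × EuclideanSpace ℝ (Fin d)) ×
      (Fin N → EuclideanSpace ℝ (Fin d)) =>
        (inner ℝ q.1.1 (q.2 i) : ℝ) * (leadSet d i).indicator 1 (q.1.2, q.2) := fun i => by
    have h1 : Measurable fun q : (EuclideanSpace ℝ (Fin d) × EuclideanSpace ℝ (Fin d)) ×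
      (Fin N → EuclideanSpace ℝ (Fin d)) => (inner ℝ q.1.1 (q.2 i) : ℝ) := by fun_prop
    have h2 : Measurable ((leadSet d i).indicator (1 :
        EuclideanSpace ℝ (Fin d) × (Fin N → EuclideanSpace ℝ (Fin d)) → ℝ)) :=
      measurable_one.indicator (measurableSet_leadSet i)
    exact h1.mul (h2.comp (by fun_prop))
  have hYm : ∀ i, Measurable (Y i) := fun i => by
    have h := (hfun i).comp ((hsc0.prodMk hsm).prodMk hxh)
    simp only [Function.comp_def] at h
    simpa only [hY, leads] using h
  have hind : ∀ i, IndepFun (Y i) (fun ω => M.residual (R.env t ω i)) P := fun i => by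
    have h1 : IndepFun (fun ω => (R.score M s ω, R.sample t ω))
        (fun ω => ((fun j => M.estimate (R.env t ω j)), M.residual (R.env t ω i))) P :=
      (hR.indepFun_prodMk_sample_env ht hsc).comp (ψ := fun e : Fin N → _ =>
        ((fun j => M.estimate (e j)), M.residual (e i))) measurable_id
        (BanditModel.measurable_estimate_pi.prodMk
          (M.residual.continuous.measurable.comp (measurable_pi_apply i)))
    have h2 : IndepFun (fun ω j => M.estimate (R.env t ω j)) (fun ω => M.residual (R.env t ω i)) P := by
      have h3 := BanditModel.indepFun_estimate_residual_jointLaw (M := M) (N := N)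
      rw [← (hR.measurePreserving_env ht).map_eq] at h3
      have h4 := IndepFun.of_map henv BanditModel.measurable_estimate_pi
        BanditModel.measurable_residual_pi h3
      exact h4.comp measurable_id (measurable_pi_apply i)
    have h3 := (IndepFun.prodMk_left_of_prodMk_right (hsc0.prodMk hsm) hxh (hres i) h1 h2).comp
      (hfun i) measurable_id
    simp only [Function.comp_def, id] at h3
    simpa only [hY, leads] using h3
  have hzero : ∀ i, ∫ ω, Y i ω * M.residual (R.env t ω i) ∂P = 0 := fun i => by
    have hmp := (BanditModel.measurePreserving_eval_jointLaw (M := M) i).comp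
      (hR.measurePreserving_env ht)
    have h0 : ∫ ω, M.residual (R.env t ω i) ∂P = 0 := by
      rw [← BanditModel.integral_residual (M := M), ← hmp.map_eq, integral_map
        hmp.measurable.aemeasurable M.residual.continuous.measurable.aestronglyMeasurable]
      rfl
    rw [(hind i).integral_fun_mul_eq_mul_integral (hYm i).aestronglyMeasurable
      (hres i).aestronglyMeasurable, h0, mul_zero]
  have hsum : (fun ω => inner ℝ (R.score M s ω) (R.score M t ω))
      =ᵐ[P] fun ω => ∑ i, Y i ω * M.residual (R.env t ω i) := by
    filter_upwards [hR.ae_leads_eq ht] with ω hω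
    simp only [hY, hω, mul_ite, mul_one, mul_zero, ite_mul, zero_mul, Finset.sum_ite_eq,
      Finset.mem_univ, if_true]
    simp only [score, chosenXhat_eq_estimate, real_inner_smul_right, mul_comm]
  rw [integral_congr_ae hsum, integral_finsetSum]
  · exact Finset.sum_eq_zero fun i _ => hzero i
  · intro i _
    refine (MemLp.integrable_inner_two (hR.memLp_score hs two_ne_zero)
      (hR.memLp_residual_smul_xhat ht i)).mono
      ((hYm i).mul (hres i)).aestronglyMeasurable (ae_of_all _ fun ω => ?_)
    simp only [hY, real_inner_smul_right, leads, norm_mul]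
    have h1 : ‖(leadSet d i).indicator (1 :
        EuclideanSpace ℝ (Fin d) × (Fin N → EuclideanSpace ℝ (Fin d)) → ℝ) (R.sample t ω, fun j => M.estimate (R.env t ω j))‖ ≤ 1 :=
      (norm_indicator_le_norm_self _ _).trans (by simp)
    calc _ ≤ ‖(inner ℝ (R.score M s ω) (M.estimate (R.env t ω i)) : ℝ)‖ * 1 * ‖M.residual (R.env t ω i)‖ := by
          gcongr
      _ = _ := by ring

theorem IsThompsonSampling.integral_norm_sum_score_sq_le (hR : R.IsThompsonSampling M P) (n : ℕ) :
    ∫ ω, ‖∑ τ ∈ Finset.Ico 1 (n + 1), R.score M τ ω‖ ^ 2 ∂P ≤ (M.scoreMoment N 2).toReal * n := by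
  simp_rw [sum_Ico_score]
  exact integral_norm_sq_sum_le_of_orthogonal (X := fun i => R.score M (i + 1))
    (fun i => hR.memLp_score (by omega) two_ne_zero) hR.integral_norm_score_sq_le
    (fun i j hij => hR.integral_inner_score (by omega) (by omega)) n

theorem IsThompsonSampling.ae_tendsto_sum_score (hR : R.IsThompsonSampling M P) :
    ∀ᵐ ω ∂P, Tendsto (fun n : ℕ => (n : ℝ)⁻¹ * ‖∑ τ ∈ Finset.Ico 1 (n + 1), R.score M τ ω‖) atTop
      (𝓝 0) := by
  simp_rw [sum_Ico_score]
  exact ae_tendsto_inv_smul_sum_of_orthogonal (X := fun i => R.score M (i + 1))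
    (fun i => hR.memLp_score (by omega) two_ne_zero) hR.integral_norm_score_sq_le
    (fun i j hij => hR.integral_inner_score (by omega) (by omega))

end BanditRun

/-! ### Mean square rates and almost sure convergence -/

/-- A covariance is at most the average of the two variances, and a variance is at most the second
moment about any centre. -/
theorem abs_randomVectorCov_apply_le {Ω : Type*} [MeasurableSpace Ω] {P : Measure Ω}
    [IsProbabilityMeasure P] {d : ℕ} {X : Ω → EuclideanSpace ℝ (Fin d)} (hX : MemLp X 2 P)
    (c : EuclideanSpace ℝ (Fin d)) (i j : Fin d) :
    |randomVectorCov X P i j| ≤ ∫ ω, ‖X ω - c‖ ^ 2 ∂P := by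
  have hcoord : ∀ k, MemLp (fun ω => X ω k) 2 P := fun k =>
    (EuclideanSpace.proj (𝕜 := ℝ) k).comp_memLp' hX
  have hXc : MemLp (fun ω => X ω - c) 2 P := hX.sub (memLp_const c)
  have hvar : ∀ k, Var[fun ω => X ω k; P] ≤ ∫ ω, ‖X ω - c‖ ^ 2 ∂P := fun k => by
    rw [← variance_sub_const (hcoord k).1 (c k)]
    refine (variance_le_expectation_sq ((hcoord k).1.sub aestronglyMeasurable_const)).trans ?_
    refine integral_mono ((hcoord k).sub (memLp_const (c k))).integrable_sq
      (hXc.integrable_norm_pow two_ne_zero) fun ω => ?_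
    have := PiLp.norm_apply_le (X ω - c) k
    rw [Real.norm_eq_abs] at this
    simp only [Pi.pow_apply]
    rw [← sq_abs]
    exact pow_le_pow_left₀ (abs_nonneg _) this 2
  have hint : ∀ k, MemLp (fun ω => X ω k - P[fun ω => X ω k]) 2 P := fun k =>
    (hcoord k).sub (memLp_const _)
  change |∫ ω, (X ω i - P[fun ω => X ω i]) * (X ω j - P[fun ω => X ω j]) ∂P| ≤ _
  calc _ ≤ ∫ ω, |(X ω i - P[fun ω => X ω i]) * (X ω j - P[fun ω => X ω j])| ∂P :=
        abs_integral_le_integral_abs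
    _ ≤ ∫ ω, (1 / 2 * (X ω i - P[fun ω => X ω i]) ^ 2 + 1 / 2 * (X ω j - P[fun ω => X ω j]) ^ 2) ∂P := by
        refine integral_mono ((hint i).integrable_mul (hint j)).abs
          (((hint i).integrable_sq.const_mul _).add ((hint j).integrable_sq.const_mul _)) fun ω => ?_
        simp only
        rw [abs_mul, ← sq_abs (X ω i - _), ← sq_abs (X ω j - _)]
        linarith [two_mul_le_add_sq |X ω i - P[fun ω => X ω i]| |X ω j - P[fun ω => X ω j]|]
    _ = 1 / 2 * Var[fun ω => X ω i; P] + 1 / 2 * Var[fun ω => X ω j; P] := by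
        rw [integral_add ((hint i).integrable_sq.const_mul _) ((hint j).integrable_sq.const_mul _),
          integral_const_mul, integral_const_mul, variance_eq_integral (hcoord i).1.aemeasurable,
          variance_eq_integral (hcoord j).1.aemeasurable]
    _ ≤ _ := by linarith [hvar i, hvar j]

namespace BanditRun

variable {Ω : Type*} [MeasurableSpace Ω] {P : Measure Ω} {d N : ℕ}
  {R : BanditRun Ω d N} {M : BanditModel d}

theorem IsThompsonSampling.measurable_muHat (hR : R.IsThompsonSampling M P) (t : ℕ) :
    Measurable (R.muHat M t) :=
  measurable_fst.comp (hR.measurable_posterior t)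

variable [IsProbabilityMeasure P]

/-- The bad event has probability `O(n⁻⁶)` and there the norm is bounded by the prior, so it does no
harm to powers up to `6`. -/
theorem IsThompsonSampling.exists_lintegral_norm_B_inv_pow_le (hR : R.IsThompsonSampling M P)
    {q : ℕ} (hq : q ≤ 6) :
    ∃ K : ℝ, ∀ n : ℕ, ∫⁻ ω, ‖(R.B M (n + 1) ω)⁻¹‖ₑ ^ q ∂P
      ≤ ENNReal.ofReal (K * (((n : ℝ) + 1) ^ q)⁻¹) := by
  obtain ⟨bad, b, C, hb, hC, hbm, hbP, hball, hgood⟩ := hR.exists_norm_B_inv_le 6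
  refine ⟨(b⁻¹) ^ q * (1 + C), fun n => ?_⟩
  have hx : (1 : ℝ) ≤ (n : ℝ) + 1 := by linarith [(Nat.cast_nonneg n : (0 : ℝ) ≤ n)]
  have hpt : ∀ ω, ‖(R.B M (n + 1) ω)⁻¹‖ₑ ^ q ≤ ENNReal.ofReal ((b⁻¹) ^ q * (((n : ℝ) + 1) ^ q)⁻¹)
      + (bad n).indicator (fun _ => ENNReal.ofReal ((b⁻¹) ^ q)) ω := fun ω => by
    rw [← ofReal_norm, ← ENNReal.ofReal_pow (norm_nonneg _)]
    by_cases hω : ω ∈ bad n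
    · rw [Set.indicator_of_mem hω]
      refine le_add_left (ENNReal.ofReal_le_ofReal ?_)
      gcongr
      exact hball _ ω
    · rw [Set.indicator_of_notMem hω, add_zero]
      refine ENNReal.ofReal_le_ofReal ?_
      rw [← inv_pow, ← mul_pow, ← mul_inv]
      gcongr
      exact hgood n ω hω
  refine (lintegral_mono hpt).trans ?_
  rw [lintegral_add_left measurable_const, lintegral_const, measure_univ, mul_one,
    lintegral_indicator_const (hbm n)]
  calc _ ≤ ENNReal.ofReal ((b⁻¹) ^ q * (((n : ℝ) + 1) ^ q)⁻¹) + ENNReal.ofReal ((b⁻¹) ^ q) *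
        ENNReal.ofReal (C * (((n : ℝ) + 1) ^ 6)⁻¹) := by gcongr; exact hbP n
    _ = ENNReal.ofReal ((b⁻¹) ^ q * (((n : ℝ) + 1) ^ q)⁻¹ +
        (b⁻¹) ^ q * (C * (((n : ℝ) + 1) ^ 6)⁻¹)) := by
      rw [← ENNReal.ofReal_mul (by positivity), ← ENNReal.ofReal_add (by positivity) (by positivity)]
    _ ≤ _ := by
      refine ENNReal.ofReal_le_ofReal ?_
      have : (((n : ℝ) + 1) ^ 6)⁻¹ ≤ (((n : ℝ) + 1) ^ q)⁻¹ := by gcongr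
      calc _ ≤ (b⁻¹) ^ q * (((n : ℝ) + 1) ^ q)⁻¹ + (b⁻¹) ^ q * (C * (((n : ℝ) + 1) ^ q)⁻¹) := by
            gcongr
        _ = _ := by ring

theorem IsThompsonSampling.exists_lintegral_sample_sub_muHat_le (hR : R.IsThompsonSampling M P)
    {q : ℕ} (hq : q ≤ 6) :
    ∃ K : ℝ, ∀ n : ℕ, ∫⁻ ω, ‖R.sample (n + 1) ω - R.muHat M (n + 1) ω‖ₑ ^ (2 * q) ∂P
      ≤ ENNReal.ofReal (K * (((n : ℝ) + 1) ^ q)⁻¹) := by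
  obtain ⟨K, hK⟩ := hR.exists_lintegral_norm_B_inv_pow_le hq
  refine ⟨(stdGaussianMoment d q).toReal * K, fun n => ?_⟩
  refine (hR.lintegral_enorm_sample_sub_muHat_le (by omega) q).trans ?_
  rw [mul_assoc, ENNReal.ofReal_mul ENNReal.toReal_nonneg,
    ENNReal.ofReal_toReal (stdGaussianMoment_ne_top d q), mul_comm]
  gcongr
  exact hK n

/-- On the good event, `n⁻²` times a second moment of order `n`. On the bad event `B` and the scores
are dependent, so the two factors are separated by a weighted Young inequality. -/
theorem IsThompsonSampling.exists_integral_muHat_sub_muStar_le (hR : R.IsThompsonSampling M P) :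
    ∃ K : ℝ, ∀ n : ℕ, MemLp (fun ω => R.muHat M (n + 1) ω - M.muStar) 2 P ∧
      ∫ ω, ‖R.muHat M (n + 1) ω - M.muStar‖ ^ 2 ∂P ≤ K * ((n : ℝ) + 1)⁻¹ := by
  obtain ⟨bad, b, C, hb, hC, hbm, hbP, hball, hgood⟩ := hR.exists_norm_B_inv_le 6
  set w : ℝ := ‖Matrix.toEuclideanCLM (𝕜 := ℝ) M.prior⁻¹ M.muStar‖ with hw
  set C2 := (M.scoreMoment N 2).toReal with hC2
  set C4 := (M.scoreMoment N 4).toReal with hC4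
  have hC20 : 0 ≤ C2 := ENNReal.toReal_nonneg
  have hC40 : 0 ≤ C4 := ENNReal.toReal_nonneg
  refine ⟨2 * (b⁻¹) ^ 2 * (C2 + w ^ 2 + C4 + (1 + w ^ 2) * C), fun n => ?_⟩
  set x : ℝ := (n : ℝ) + 1 with hx
  have hn0 : (0 : ℝ) ≤ n := Nat.cast_nonneg n
  have hnx : (n : ℝ) ≤ x := by linarith
  have hx1 : 1 ≤ x := by linarith
  have hx0 : 0 < x := by linarith
  set W : Ω → EuclideanSpace ℝ (Fin d) := fun ω => ∑ τ ∈ Finset.Ico 1 (n + 1), R.score M τ ω with hW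
  have hW2 : Integrable (fun ω => ‖W ω‖ ^ 2) P :=
    (hR.memLp_sum_score n (p := 2) two_ne_zero).integrable_norm_pow two_ne_zero
  have hW4 : Integrable (fun ω => ‖W ω‖ ^ 4) P :=
    (hR.memLp_sum_score n (p := 4) (by norm_num)).integrable_norm_pow (by norm_num)
  -- On the bad event `‖W‖² ≤ x⁻⁵ ‖W‖⁴ + x⁵`. The fourth moment is `O(x⁴)` and the event has
  -- probability `O(x⁻⁶)`, so the weight `x⁵` makes both terms `O(1/x)`.
  set g : Ω → ℝ := fun ω => 2 * (b⁻¹) ^ 2 * ((x ^ 2)⁻¹ * (‖W ω‖ ^ 2 + w ^ 2) +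
    ((x ^ 5)⁻¹ * ‖W ω‖ ^ 4 + (bad n).indicator (fun _ => x ^ 5 + w ^ 2) ω)) with hg
  have hind : Integrable ((bad n).indicator (fun _ : Ω => x ^ 5 + w ^ 2)) P :=
    (integrable_const _).indicator (hbm n)
  have hi1 : Integrable (fun ω => (x ^ 2)⁻¹ * (‖W ω‖ ^ 2 + w ^ 2)) P :=
    (hW2.add (integrable_const _)).const_mul _
  have hi2 : Integrable (fun ω => (x ^ 5)⁻¹ * ‖W ω‖ ^ 4) P := hW4.const_mul _
  have hi3 : Integrable (fun ω => (x ^ 5)⁻¹ * ‖W ω‖ ^ 4 +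
      (bad n).indicator (fun _ => x ^ 5 + w ^ 2) ω) P := hi2.add hind
  have hgi : Integrable g P := (hi1.add hi3).const_mul _
  have hpt : ∀ ω, ‖R.muHat M (n + 1) ω - M.muStar‖ ^ 2 ≤ g ω := fun ω => by
    have h1 := norm_muHat_sub_muStar_le (R := R) (M := M) (n + 1) ω
    have h2 : ‖R.muHat M (n + 1) ω - M.muStar‖ ^ 2
        ≤ ‖(R.B M (n + 1) ω)⁻¹‖ ^ 2 * (2 * (‖W ω‖ ^ 2 + w ^ 2)) := by
      calc _ ≤ (‖(R.B M (n + 1) ω)⁻¹‖ * (‖W ω‖ + w)) ^ 2 := by gcongr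
        _ = ‖(R.B M (n + 1) ω)⁻¹‖ ^ 2 * (‖W ω‖ + w) ^ 2 := mul_pow _ _ _
        _ ≤ _ := by
          gcongr
          exact add_sq_le
    have h4 : 0 ≤ (x ^ 5)⁻¹ * ‖W ω‖ ^ 4 := by positivity
    have h5 : 0 ≤ (x ^ 2)⁻¹ * (‖W ω‖ ^ 2 + w ^ 2) := by positivity
    refine h2.trans ?_
    by_cases hω : ω ∈ bad n
    · have h3 : ‖W ω‖ ^ 2 ≤ (x ^ 5)⁻¹ * ‖W ω‖ ^ 4 + x ^ 5 := by
        have h6 := two_mul_le_add_sq (‖W ω‖ ^ 2) (x ^ 5)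
        have h7 : (x ^ 5)⁻¹ * ‖W ω‖ ^ 4 + x ^ 5 = (x ^ 5)⁻¹ * ((‖W ω‖ ^ 2) ^ 2 + (x ^ 5) ^ 2) := by
          field_simp
        rw [h7, inv_mul_eq_div, le_div_iff₀ (by positivity)]
        have : 0 ≤ ‖W ω‖ ^ 2 * x ^ 5 := by positivity
        linarith
      simp only [hg, Set.indicator_of_mem hω]
      calc _ ≤ (b⁻¹) ^ 2 * (2 * (‖W ω‖ ^ 2 + w ^ 2)) := by gcongr; exact hball _ ω
        _ = 2 * (b⁻¹) ^ 2 * (‖W ω‖ ^ 2 + w ^ 2) := by ring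
        _ ≤ _ := by
          refine mul_le_mul_of_nonneg_left ?_ (by positivity)
          linarith
    · simp only [hg, Set.indicator_of_notMem hω]
      calc _ ≤ ((b * x)⁻¹) ^ 2 * (2 * (‖W ω‖ ^ 2 + w ^ 2)) := by gcongr; exact hgood n ω hω
        _ = 2 * (b⁻¹) ^ 2 * ((x ^ 2)⁻¹ * (‖W ω‖ ^ 2 + w ^ 2)) := by
          rw [mul_inv, mul_pow, inv_pow x]; ring
        _ ≤ _ := by
          refine mul_le_mul_of_nonneg_left ?_ (by positivity)
          linarith
  have hmeas : AEStronglyMeasurable (fun ω => R.muHat M (n + 1) ω - M.muStar) P :=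
    ((hR.measurable_muHat _).sub_const _).aestronglyMeasurable
  have hint : Integrable (fun ω => ‖R.muHat M (n + 1) ω - M.muStar‖ ^ 2) P :=
    hgi.mono' (hmeas.norm.pow 2) (ae_of_all _ fun ω => by
      rw [Real.norm_of_nonneg (by positivity)]; exact hpt ω)
  refine ⟨(memLp_two_iff_integrable_sq_norm hmeas).2 hint, ?_⟩
  have hW2i : ∫ ω, ‖W ω‖ ^ 2 ∂P ≤ C2 * x :=
    (hR.integral_norm_sum_score_sq_le n).trans (by gcongr)
  have hW4i : ∫ ω, ‖W ω‖ ^ 4 ∂P ≤ C4 * x ^ 4 :=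
    (hR.integral_norm_sum_score_pow_four_le n).trans (by gcongr)
  have hbadr : P.real (bad n) ≤ C * (x ^ 6)⁻¹ := ENNReal.toReal_le_of_le_ofReal (by positivity) (hbP n)
  calc _ ≤ ∫ ω, g ω ∂P := integral_mono hint hgi hpt
    _ = 2 * (b⁻¹) ^ 2 * ((x ^ 2)⁻¹ * (∫ ω, ‖W ω‖ ^ 2 ∂P + w ^ 2) +
        ((x ^ 5)⁻¹ * ∫ ω, ‖W ω‖ ^ 4 ∂P + P.real (bad n) * (x ^ 5 + w ^ 2))) := by
      rw [hg, integral_const_mul, integral_add hi1 hi3, integral_add hi2 hind,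
        integral_const_mul, integral_add hW2 (integrable_const _), integral_const_mul,
        integral_indicator_const _ (hbm n)]
      simp
    _ ≤ 2 * (b⁻¹) ^ 2 * ((x ^ 2)⁻¹ * (C2 * x + w ^ 2 * x) +
        ((x ^ 5)⁻¹ * (C4 * x ^ 4) + C * (x ^ 6)⁻¹ * (x ^ 5 + w ^ 2 * x ^ 5))) := by
      gcongr
      · exact le_mul_of_one_le_right (sq_nonneg w) hx1
      · exact le_mul_of_one_le_right (sq_nonneg w) (one_le_pow₀ hx1)
    _ = _ := by
      field_simp
      ring

/-- By Borel–Cantelli the bad events eventually stop, so the error is bounded by a multiple of `1/n`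
times the sum of scores plus the fixed bias. -/
theorem IsThompsonSampling.ae_tendsto_muHat (hR : R.IsThompsonSampling M P) :
    ∀ᵐ ω ∂P, Tendsto (fun n => R.muHat M (n + 1) ω) atTop (𝓝 M.muStar) := by
  obtain ⟨bad, b, C, hb, hC, hbm, hbP, hball, hgood⟩ := hR.exists_norm_B_inv_le 2
  have hs : Summable fun n : ℕ => C * (((n : ℝ) + 1) ^ 2)⁻¹ := by
    have := (summable_nat_add_iff 1).2 (Real.summable_nat_pow_inv.2 (one_lt_two))
    simpa using this.mul_left C
  have hfin : ∑' n, P (bad n) ≠ ⊤ :=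
    ne_top_of_le_ne_top hs.tsum_ofReal_ne_top (ENNReal.tsum_le_tsum hbP)
  filter_upwards [ae_eventually_notMem hfin, hR.ae_tendsto_sum_score] with ω h1 h2
  rw [tendsto_iff_norm_sub_tendsto_zero]
  set w : ℝ := ‖Matrix.toEuclideanCLM (𝕜 := ℝ) M.prior⁻¹ M.muStar‖ with hw
  have hlim : Tendsto (fun n : ℕ => b⁻¹ * ((n : ℝ)⁻¹ *
      ‖∑ τ ∈ Finset.Ico 1 (n + 1), R.score M τ ω‖ + (n : ℝ)⁻¹ * w)) atTop (𝓝 0) := by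
    have h3 : Tendsto (fun n : ℕ => (n : ℝ)⁻¹ * w) atTop (𝓝 0) := by
      simpa using (tendsto_inv_atTop_nhds_zero_nat (𝕜 := ℝ)).mul_const w
    simpa using (h2.add h3).const_mul b⁻¹
  refine squeeze_zero' (Eventually.of_forall fun n => norm_nonneg _) ?_ hlim
  filter_upwards [h1, eventually_ge_atTop 1] with n hn hn1
  have hn1' : (1 : ℝ) ≤ n := by exact_mod_cast hn1
  calc _ ≤ ‖(R.B M (n + 1) ω)⁻¹‖ * (‖∑ τ ∈ Finset.Ico 1 (n + 1), R.score M τ ω‖ + w) :=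
        norm_muHat_sub_muStar_le _ ω
    _ ≤ (b * n)⁻¹ * (‖∑ τ ∈ Finset.Ico 1 (n + 1), R.score M τ ω‖ + w) := by
        gcongr
        refine (hgood n ω hn).trans ?_
        gcongr
        linarith
    _ = _ := by rw [mul_inv]; ring

theorem IsThompsonSampling.ae_tendsto_sample (hR : R.IsThompsonSampling M P) :
    ∀ᵐ ω ∂P, Tendsto (fun t => R.sample t ω) atTop (𝓝 M.muStar) := by
  -- Fourth moments are needed here: second moments decay only like `1/n`, which is not summable.
  obtain ⟨K, hK⟩ := hR.exists_lintegral_sample_sub_muHat_le (q := 2) (by norm_num)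
  have hdiff := ae_tendsto_zero_of_lintegral_enorm_pow_le (P := P) (p := 4)
    (f := fun n ω => R.sample (n + 1) ω - R.muHat M (n + 1) ω)
    (fun n => ((hR.measurable_sample _ (by omega)).sub
      (hR.measurable_muHat _)).aestronglyMeasurable) (by norm_num) K hK
  filter_upwards [hdiff, hR.ae_tendsto_muHat] with ω h1 h2
  rw [← tendsto_add_atTop_iff_nat 1]
  simpa using h1.add h2

theorem IsThompsonSampling.exists_integral_sample_sub_muStar_le (hR : R.IsThompsonSampling M P) :
    ∃ K : ℝ, ∀ n : ℕ, MemLp (R.sample (n + 1)) 2 P ∧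
      ∫ ω, ‖R.sample (n + 1) ω - M.muStar‖ ^ 2 ∂P ≤ K * ((n : ℝ) + 1)⁻¹ := by
  obtain ⟨K₁, hK₁⟩ := hR.exists_lintegral_sample_sub_muHat_le (q := 1) (by norm_num)
  obtain ⟨K₂, hK₂⟩ := hR.exists_integral_muHat_sub_muStar_le
  refine ⟨2 * (max K₁ 0 + K₂), fun n => ?_⟩
  obtain ⟨hmu, hmuK⟩ := hK₂ n
  have hm : AEStronglyMeasurable (fun ω => R.sample (n + 1) ω - R.muHat M (n + 1) ω) P :=
    ((hR.measurable_sample _ (by omega)).sub (hR.measurable_muHat _)).aestronglyMeasurable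
  have hK := hK₁ n
  simp only [mul_one, pow_one] at hK
  have hdiff : MemLp (fun ω => R.sample (n + 1) ω - R.muHat M (n + 1) ω) 2 P :=
    memLp_natCast_of_lintegral_enorm_pow_ne_top hm two_ne_zero
      (ne_top_of_le_ne_top ENNReal.ofReal_ne_top hK)
  have hdiffK : ∫ ω, ‖R.sample (n + 1) ω - R.muHat M (n + 1) ω‖ ^ 2 ∂P
      ≤ max K₁ 0 * ((n : ℝ) + 1)⁻¹ := by
    rw [integral_norm_pow_eq_toReal_lintegral hm]
    refine ENNReal.toReal_le_of_le_ofReal (by positivity) (hK.trans (ENNReal.ofReal_le_ofReal ?_))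
    gcongr
    exact le_max_left _ _
  have hsub : MemLp (fun ω => R.sample (n + 1) ω - M.muStar) 2 P := by
    have h : (fun ω => R.sample (n + 1) ω - M.muStar) =
        (fun ω => R.sample (n + 1) ω - R.muHat M (n + 1) ω) +
          fun ω => R.muHat M (n + 1) ω - M.muStar := by funext ω; simp
    rw [h]
    exact hdiff.add hmu
  have hsample : R.sample (n + 1) =
      (fun ω => R.sample (n + 1) ω - M.muStar) + fun _ => M.muStar := by funext ω; simp
  refine ⟨hsample ▸ hsub.add (memLp_const M.muStar), ?_⟩
  calc ∫ ω, ‖R.sample (n + 1) ω - M.muStar‖ ^ 2 ∂P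
      ≤ ∫ ω, 2 * (‖R.sample (n + 1) ω - R.muHat M (n + 1) ω‖ ^ 2
          + ‖R.muHat M (n + 1) ω - M.muStar‖ ^ 2) ∂P := by
        refine integral_mono (hsub.integrable_norm_pow two_ne_zero)
          (((hdiff.integrable_norm_pow two_ne_zero).add
            (hmu.integrable_norm_pow two_ne_zero)).const_mul 2) fun ω => ?_
        simp only
        rw [← sub_add_sub_cancel (R.sample (n + 1) ω) (R.muHat M (n + 1) ω) M.muStar]
        exact (pow_le_pow_left₀ (norm_nonneg _) (norm_add_le _ _) 2).trans add_sq_le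
    _ ≤ 2 * (max K₁ 0 * ((n : ℝ) + 1)⁻¹ + K₂ * ((n : ℝ) + 1)⁻¹) := by
        rw [integral_const_mul, integral_add (hdiff.integrable_norm_pow two_ne_zero)
          (hmu.integrable_norm_pow two_ne_zero)]
        gcongr
    _ = _ := by ring

end BanditRun

theorem corollary1 {Ω : Type*} [MeasurableSpace Ω] (P : Measure Ω) [IsProbabilityMeasure P]
    {d N : ℕ} (M : BanditModel d) (R : BanditRun Ω d N) (hR : R.IsThompsonSampling M P) :
    (∀ᵐ ω ∂P, Tendsto (fun t => R.sample t ω) atTop (𝓝 M.muStar)) ∧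
    (∀ t, 1 ≤ t → MemLp (R.sample t) 2 P) ∧
    (fun t : ℕ => ‖randomVectorCov (R.sample t) P‖) =O[atTop] (fun t : ℕ => (t : ℝ)⁻¹) := by
  obtain ⟨K, hK⟩ := hR.exists_integral_sample_sub_muStar_le
  refine ⟨hR.ae_tendsto_sample, fun t ht => ?_, ?_⟩
  · obtain ⟨n, rfl⟩ := Nat.exists_eq_add_of_le' ht
    exact (hK n).1
  -- The sum of norms of matrix units passes from entries to the operator norm; the entries are
  -- bounded by the mean square error about `μ_*`.
  · refine IsBigO.of_bound ((∑ i, ∑ j, ‖Matrix.single (i : Fin d) (j : Fin d) (1 : ℝ)‖) * K) ?_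
    filter_upwards [eventually_ge_atTop 1] with t ht
    obtain ⟨n, rfl⟩ := Nat.exists_eq_add_of_le' ht
    rw [norm_norm, Real.norm_of_nonneg (by positivity), mul_assoc]
    push_cast
    exact l2_opNorm_le_of_abs_entry_le fun i j =>
      (abs_randomVectorCov_apply_le (hK n).1 M.muStar i j).trans (hK n).2
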